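/- Let $N,d_0,d_1,d_2\ge 1$ be integers and $X\in\mathbb R^{N\times d_0}$, $Y\in\mathbb R^{N\times d_2}$. For $\theta=(W,V)$ with $W\in\mathbb R^{d_0\times d_1}$, $V\in\mathbb R^{d_1\times d_2}$, identified with a vector of $\mathbb R^D$, $D=d_0d_1+d_1d_2$, with Euclidean norm $\|\theta\|$, put $H(\theta)=\phi(XW)$, where $\phi(x)=\max(x,0)$ is applied entrywise, and $$\mathcal L(\theta)=\tfrac12\|Y-H(\theta)V\|_F^2,\qquad \alpha_0(\theta)=\sigma_{\min}(H(\theta)^T),\qquad \sigma_{\min}(A)=\sqrt{\lambda_{\min}(A^TA)}.$$ Here $\|\cdot\|_F$ is the Frobenius norm and $\|\cdot\|_{op}$ the operator norm for Euclidean norms. Let $\partial\mathcal L(\theta)$ denote the Clarke subdifferential, i.e. the convex hull of all limits $\lim_n\nabla\mathcal L(\theta_n)$ along sequences $\theta_n\to\theta$ of points of differentiability of $\mathcal L$. For an interval $I=[0,T)$ with $0<T<\infty$ or $I=\mathbb R_+=[0,\infty)$, a solution on $I$ of the differential inclusion $$\theta(0)=\theta_0,\qquad \dot\theta(t)\in-\partial\mathcal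 L(\theta(t))\ \text{ for a.e. } t\in I$$ is a curve $\theta\colon I\to\mathbb R^D$ that satisfies it and is absolutely continuous, i.e. $\theta(t)-\theta(0)=\int_0^t v(s)\,ds$ for all $t\in I$ with some $v$ integrable on compact subintervals of $I$. Let $\theta_0=(W_0,V_0)\in\mathbb R^D$ and set $a=\sqrt{\mathcal L(\theta_0)}$, $\alpha=\alpha_0(\theta_0)$, $c_1=2\sqrt2\,\|X\|_{op}^2\|V_0\|_F$, $c_2=2\|X\|_{op}^3\|W_0\|_F$, $c=\|X\|_{op}^2$. Assume that $\alpha>0$ and $$F(\theta_0,X,Y)=\Big(\frac{ac_1}{\alpha^3}+\frac{a^2c_2}{\alpha^5}\Big)\exp\Big(\frac{4ca^2}{\alpha^4}\Big)<\frac18 .$$ Then every solution $\theta$ on $[0,T)$, $0<T<\infty$, of the differential inclusion can be extended to a solution on $\mathbb R_+$, and any such extension satisfies, for all $t\ge0$, $$\mathcal L(\theta(t))\le\mathcal L(\theta_0)\,e^{-t\alpha^2}\qquad\text{and}\qquad \|\theta(t)-\theta_0\|\le u\,\|\theta_0\|\,e^{u},\qquad u=\frac{4\|X\|_{op}\sqrt{\mathcal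 L(\theta_0)}}{\alpha^2}.$$ -/

import Mathlib

open Filter Topology MeasureTheory

noncomputable section

namespace ReLUNet

/-- Operator norm of a real matrix with respect to the Euclidean norms. -/
def opNorm {m n : ℕ} (A : Matrix (Fin m) (Fin n) ℝ) : ℝ :=
  ‖(Matrix.toEuclideanLin A).toContinuousLinearMap‖

/-- Frobenius norm of a real matrix. -/
def frobNorm {m n : ℕ} (A : Matrix (Fin m) (Fin n) ℝ) : ℝ :=
  Real.sqrt (∑ i, ∑ j, A i j ^ 2)

/-- Smallest eigenvalue of a real symmetric matrix. -/
def lambdaMin {n : ℕ} (A : Matrix (Fin n) (Fin n) ℝ) (hA : A.IsHermitian) : ℝ :=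
  ⨅ i, hA.eigenvalues i

theorem isHermitian_transpose_mul_self {m n : ℕ} (A : Matrix (Fin m) (Fin n) ℝ) :
    (A.transpose * A).IsHermitian := by
  have h := Matrix.isHermitian_conjTranspose_mul_self A
  rwa [Matrix.conjTranspose_eq_transpose_of_trivial] at h

/-- `σ_min(A) = √(λ_min(Aᵀ A))`. -/
def sigmaMin {m n : ℕ} (A : Matrix (Fin m) (Fin n) ℝ) : ℝ :=
  Real.sqrt (lambdaMin (A.transpose * A) (isHermitian_transpose_mul_self A))

/-- The ReLU activation function. -/
def relu (x : ℝ) : ℝ := max x 0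

/-- Parameter space of pairs `θ = (W, V)` with `W` of size `d₀ × d₁` and `V` of size `d₁ × d₂`,
listed entry by entry, with the Euclidean norm and inner product. -/
abbrev Param (d₀ d₁ d₂ : ℕ) : Type :=
  EuclideanSpace ℝ ((Fin d₀ × Fin d₁) ⊕ (Fin d₁ × Fin d₂))

variable {N d₀ d₁ d₂ : ℕ}

/-- The hidden-layer weights `W` of `θ = (W, V)`. -/
def weightW (θ : Param d₀ d₁ d₂) : Matrix (Fin d₀) (Fin d₁) ℝ :=
  Matrix.of fun i j => θ (Sum.inl (i, j))

/-- The output-layer weights `V` of `θ = (W, V)`. -/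
def weightV (θ : Param d₀ d₁ d₂) : Matrix (Fin d₁) (Fin d₂) ℝ :=
  Matrix.of fun i j => θ (Sum.inr (i, j))

/-- The hidden layer `H = φ(XW)`, with the ReLU `φ` applied to every entry. -/
def hidden (X : Matrix (Fin N) (Fin d₀) ℝ) (θ : Param d₀ d₁ d₂) : Matrix (Fin N) (Fin d₁) ℝ :=
  (X * weightW θ).map relu

/-- The network output `φ(XW)V`. -/
def output (X : Matrix (Fin N) (Fin d₀) ℝ) (θ : Param d₀ d₁ d₂) : Matrix (Fin N) (Fin d₂) ℝ :=
  hidden X θ * weightV θ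

/-- The loss `L(θ) = ½ ‖Y - φ(XW)V‖_F²`. -/
def loss (X : Matrix (Fin N) (Fin d₀) ℝ) (Y : Matrix (Fin N) (Fin d₂) ℝ)
    (θ : Param d₀ d₁ d₂) : ℝ :=
  1 / 2 * frobNorm (Y - output X θ) ^ 2

/-- `α₀ = σ_min(Hᵀ)` at the parameter `θ`. -/
def alpha (X : Matrix (Fin N) (Fin d₀) ℝ) (θ : Param d₀ d₁ d₂) : ℝ :=
  sigmaMin (hidden X θ).transpose

/-- `c₁ = 2√2 ‖X‖_op² ‖V‖_F`. -/
def constC₁ (X : Matrix (Fin N) (Fin d₀) ℝ) (θ : Param d₀ d₁ d₂) : ℝ :=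
  2 * Real.sqrt 2 * opNorm X ^ 2 * frobNorm (weightV θ)

/-- `c₂ = 2 ‖X‖_op³ ‖W‖_F`. -/
def constC₂ (X : Matrix (Fin N) (Fin d₀) ℝ) (θ : Param d₀ d₁ d₂) : ℝ :=
  2 * opNorm X ^ 3 * frobNorm (weightW θ)

/-- `c = ‖X‖_op²`. -/
def constC (X : Matrix (Fin N) (Fin d₀) ℝ) : ℝ := opNorm X ^ 2

/-- `F(θ, X, Y) = (a c₁ / α³ + a² c₂ / α⁵) exp(4 c a² / α⁴)` with `a = √L(θ)`. -/
def condF (X : Matrix (Fin N) (Fin d₀) ℝ) (Y : Matrix (Fin N) (Fin d₂) ℝ)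
    (θ : Param d₀ d₁ d₂) : ℝ :=
  (Real.sqrt (loss X Y θ) * constC₁ X θ / alpha X θ ^ 3
      + Real.sqrt (loss X Y θ) ^ 2 * constC₂ X θ / alpha X θ ^ 5)
    * Real.exp (4 * constC X * Real.sqrt (loss X Y θ) ^ 2 / alpha X θ ^ 4)

end ReLUNet

section DifferentialInclusion

variable {E : Type*} [NormedAddCommGroup E] [InnerProductSpace ℝ E] [CompleteSpace E]

/-- Clarke subdifferential: the convex hull of all limits of gradients along sequences of
differentiability points converging to `x`. -/
def clarkeSubdifferential (f : E → ℝ) (x : E) : Set E :=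
  convexHull ℝ {g | ∃ u : ℕ → E, (∀ n, DifferentiableAt ℝ f (u n)) ∧
    Tendsto u atTop (𝓝 x) ∧ Tendsto (fun n => gradient f (u n)) atTop (𝓝 g)}

/-- `x` is an arc (an absolutely continuous curve) on the interval `I`, which is to have left
endpoint `0 ∈ I`: it is the indefinite integral of a map integrable on the compact
subintervals of `I`. Values of `x` outside `I` play no role. -/
def IsArcOn (I : Set ℝ) (x : ℝ → E) : Prop :=
  ∃ v : ℝ → E, ∀ t ∈ I, IntervalIntegrable v volume 0 t ∧ x t - x 0 = ∫ s in (0 : ℝ)..t, v s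

/-- `x` solves the Cauchy problem `x(0) = x₀`, `x'(t) ∈ -∂f(x(t))` for almost every `t ∈ I`. -/
def IsSolutionOn (f : E → ℝ) (x₀ : E) (I : Set ℝ) (x : ℝ → E) : Prop :=
  x 0 = x₀ ∧ IsArcOn I x ∧
    ∀ᵐ t ∂(volume.restrict I), ∃ w : E, HasDerivAt x w t ∧ -w ∈ clarkeSubdifferential f (x t)

end DifferentialInclusion

end

/-! Write `R` for the residual. Every Clarke subgradient of the loss is a formal gradient `g` in
which each ReLU kink gets some slope in `[0,1]` (`clarkeSubdifferential_loss_subset`). Along a curve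
the slope chosen at a kink is irrelevant for almost every time, because a preactivation has
derivative zero at almost every zero where it is differentiable (`ae_hasDerivAt_loss`). Hence a
solution has velocity `-g` and dissipates the loss at the rate `‖g‖²`.

The `V`-block of `g` is `HᵀR`, so `‖g‖ ≥ (α - ‖X‖‖W - W₀‖)‖R‖`. While `‖X‖‖W - W₀‖ ≤ (29/100)α`,
this gives `‖g‖² ≥ α² L`, and the loss decays like `exp(-tα²)`. In turn `‖W'‖ ≤ ‖X‖‖R‖‖V‖` and `‖V'‖
≤ ‖X‖‖R‖‖W‖` with `‖R‖` exponentially small. Comparison with a hyperbolic linear system yields `‖W -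
W₀‖ ≤ ‖V₀‖ sinh τ + ‖W₀‖ (cosh τ - 1)`, where `τ` bounds `∫ ‖X‖‖R‖` (`bounds_of_loss_le`). The
condition on `F` makes `‖X‖` times this smaller than `α/4`, so the threshold `(29/100)α` is never
reached (`opNorm_mul_norm_projW_le`).

Extension needs no smallness. The inequality `‖g‖ ≤ (1 + ‖g‖²)/2` and dissipation bound the
displacement by `(t + L(θ₀))/2`, so a solution on `[0,T)` is Lipschitz and has a limit at `T`. A
global solution from that limit comes from truncated Euler schemes (`exists_isSolutionOn_Ici`),
using that the subdifferential is upper semicontinuous with nonempty closed convex values. -/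

/-! ### Calculus of Lipschitz curves on intervals -/

section Lipschitz

variable {E : Type*} [NormedAddCommGroup E] [NormedSpace ℝ E]

theorem lipschitzOnWith_intervalIntegral {v : ℝ → E} {a b : ℝ} (hab : a ≤ b) {K : NNReal}
    (hv : IntervalIntegrable v volume a b) (hK : ∀ᵐ s, s ∈ Set.Ioo a b → ‖v s‖ ≤ K) :
    LipschitzOnWith K (fun t => ∫ s in a..t, v s) (Set.Icc a b) := by
  refine LipschitzOnWith.of_dist_le_mul fun s hs t ht => ?_
  have hi : ∀ r ∈ Set.Icc a b, IntervalIntegrable v volume a r := fun r hr =>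
    hv.mono_set (by rw [Set.uIcc_of_le hab, Set.uIcc_of_le hr.1]; exact Set.Icc_subset_Icc_right hr.2)
  rw [dist_eq_norm, intervalIntegral.integral_interval_sub_left (hi s hs) (hi t ht),
    Real.dist_eq]
  refine intervalIntegral.norm_integral_le_of_norm_le_const_ae ?_
  have hb : ∀ᵐ r : ℝ, r ≠ b := by simp [ae_iff, measure_singleton]
  filter_upwards [hK, hb] with r hr hrb hr'
  rw [Set.uIoc, Set.mem_Ioc] at hr'
  refine hr ⟨lt_of_le_of_lt (le_min ht.1 hs.1) hr'.1, lt_of_le_of_ne (hr'.2.trans (max_le ht.2 hs.2)) hrb⟩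

theorem LipschitzOnWith.Icc_glue {E : Type*} [PseudoMetricSpace E] {x : ℝ → E} {K₁ K₂ : NNReal} {a b c : ℝ} (hab : a ≤ b)
    (h₁ : LipschitzOnWith K₁ x (Set.Icc a b)) (h₂ : LipschitzOnWith K₂ x (Set.Icc b c)) :
    LipschitzOnWith (max K₁ K₂) x (Set.Icc a c) := by
  have key : ∀ s ∈ Set.Icc a c, ∀ t ∈ Set.Icc a c, s ≤ t →
      dist (x s) (x t) ≤ ((max K₁ K₂ : NNReal) : ℝ) * dist s t := by
    intro s hs t ht hst
    have m1 : (K₁ : ℝ) ≤ (max K₁ K₂ : NNReal) := by exact_mod_cast le_max_left _ _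
    have m2 : (K₂ : ℝ) ≤ (max K₁ K₂ : NNReal) := by exact_mod_cast le_max_right _ _
    rcases le_total t b with htb | htb
    · exact (h₁.dist_le_mul s ⟨hs.1, hst.trans htb⟩ t ⟨ht.1, htb⟩).trans
        (mul_le_mul_of_nonneg_right m1 dist_nonneg)
    rcases le_total b s with hsb | hsb
    · exact (h₂.dist_le_mul s ⟨hsb, hs.2⟩ t ⟨htb, ht.2⟩).trans
        (mul_le_mul_of_nonneg_right m2 dist_nonneg)
    have e1 := (h₁.dist_le_mul s ⟨hs.1, hsb⟩ b ⟨hab, le_rfl⟩).trans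
        (mul_le_mul_of_nonneg_right m1 dist_nonneg)
    have e2 := (h₂.dist_le_mul b ⟨le_rfl, htb.trans ht.2⟩ t ⟨htb, ht.2⟩).trans
        (mul_le_mul_of_nonneg_right m2 dist_nonneg)
    have e3 : dist s t = dist s b + dist b t := by
      rw [Real.dist_eq, Real.dist_eq, Real.dist_eq, abs_of_nonpos, abs_of_nonpos, abs_of_nonpos] <;>
        linarith
    rw [e3, mul_add]
    exact (dist_triangle _ _ _).trans (add_le_add e1 e2)
  refine LipschitzOnWith.of_dist_le_mul fun s hs t ht => ?_
  rcases le_total s t with h | h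
  · exact key s hs t ht h
  · rw [dist_comm, dist_comm s]; exact key t ht s hs h

variable [FiniteDimensional ℝ E]

theorem LipschitzOnWith.intervalIntegrable_deriv {x : ℝ → E} {K : NNReal} {a b : ℝ} (hab : a ≤ b)
    (h : LipschitzOnWith K x (Set.Icc a b)) : IntervalIntegrable (deriv x) volume a b := by
  have : CompleteSpace E := FiniteDimensional.complete ℝ E
  rw [intervalIntegrable_iff_integrableOn_Ioo_of_le hab]
  refine Measure.integrableOn_of_bounded (M := K) (by simp)
    (stronglyMeasurable_deriv x).aestronglyMeasurable ?_
  refine (ae_restrict_iff' measurableSet_Ioo).2 (Eventually.of_forall fun s hs => ?_)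
  exact norm_deriv_le_of_lipschitzOn (Icc_mem_nhds hs.1 hs.2) h

theorem LipschitzOnWith.ae_differentiableAt_Ioo {x : ℝ → E} {K : NNReal} {a b : ℝ}
    (h : LipschitzOnWith K x (Set.Icc a b)) :
    ∀ᵐ t, t ∈ Set.Ioo a b → DifferentiableAt ℝ x t := by
  filter_upwards [h.ae_differentiableWithinAt_of_mem_real] with t ht ht'
  exact (ht (Set.Ioo_subset_Icc_self ht')).differentiableAt (Icc_mem_nhds ht'.1 ht'.2)

/-- The difference between the curve and the primitive of its derivative is absolutely continuous
with derivative zero almost everywhere, hence constant. -/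
theorem LipschitzOnWith.intervalIntegral_deriv_eq_sub {x : ℝ → E} {K : NNReal} {a b : ℝ}
    (hab : a ≤ b) (h : LipschitzOnWith K x (Set.Icc a b)) :
    ∫ s in a..b, deriv x s = x b - x a := by
  have : CompleteSpace E := FiniteDimensional.complete ℝ E
  have hi := h.intervalIntegrable_deriv hab
  have h1 : LipschitzOnWith K (fun t => ∫ s in a..t, deriv x s) (Set.Icc a b) :=
    lipschitzOnWith_intervalIntegral hab hi (Eventually.of_forall fun s hs =>
      norm_deriv_le_of_lipschitzOn (Icc_mem_nhds hs.1 hs.2) h)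
  have hac : AbsolutelyContinuousOnInterval (fun t => x t - ∫ s in a..t, deriv x s) a b := by
    rw [← Set.uIcc_of_le hab] at h h1
    exact h.absolutelyContinuousOnInterval.sub h1.absolutelyContinuousOnInterval
  have ha : ∀ᵐ r : ℝ, r ≠ a := by simp [ae_iff, measure_singleton]
  have hb : ∀ᵐ r : ℝ, r ≠ b := by simp [ae_iff, measure_singleton]
  obtain ⟨c, hc⟩ := hac.const_of_ae_hasDerivAt_zero (by
    filter_upwards [h.ae_differentiableAt_Ioo, hi.ae_hasDerivAt_integral, ha, hb]
      with t h1 h2 h3 h4 h5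
    rw [Set.uIcc_of_le hab] at h5
    have := (h1 ⟨lt_of_le_of_ne h5.1 h3.symm, lt_of_le_of_ne h5.2 h4⟩).hasDerivAt.sub
      (h2 (by rwa [Set.uIcc_of_le hab]) a Set.left_mem_uIcc)
    rw [sub_self] at this; exact this)
  have e1 := hc a Set.left_mem_uIcc
  have e2 := hc b Set.right_mem_uIcc
  simp only [intervalIntegral.integral_same, sub_zero] at e1
  rw [e1, ← e2]; abel

theorem LipschitzOnWith.le_of_ae_hasDerivAt_nonpos {f : ℝ → ℝ} {K : NNReal} {a b : ℝ}
    (hab : a ≤ b) (h : LipschitzOnWith K f (Set.Icc a b))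
    (hf : ∀ᵐ t, t ∈ Set.Ioo a b → ∃ d ≤ 0, HasDerivAt f d t) : f b ≤ f a := by
  have h1 := h.intervalIntegral_deriv_eq_sub hab
  have h2 : ∫ s in a..b, deriv f s ≤ 0 := by
    rw [intervalIntegral.integral_of_le hab, integral_Ioc_eq_integral_Ioo]
    refine integral_nonpos_of_ae ?_
    refine (ae_restrict_iff' measurableSet_Ioo).2 ?_
    filter_upwards [hf] with t ht ht'
    obtain ⟨d, hd, hd'⟩ := ht ht'
    simpa [hd'.deriv] using hd
  linarith

end Lipschitz

/-! ### Derivatives at zeros, hyperbolic estimates and a comparison principle -/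

theorem HasDerivAt.eq_zero_of_not_isolated {f : ℝ → ℝ} {d t : ℝ} (hd : HasDerivAt f d t)
    (h : 𝓝[{s | f s = 0} ∩ Set.Ioi t] t ≠ ⊥) : d = 0 := by
  have : NeBot (𝓝[{s | f s = 0} ∩ Set.Ioi t] t) := ⟨h⟩
  by_contra hne
  have h1 : ∀ᶠ z in 𝓝[{s | f s = 0} ∩ Set.Ioi t] t, f z ≠ 0 :=
    (hd.eventually_ne (c := 0) hne).filter_mono (nhdsWithin_mono _ fun z hz => ne_of_gt hz.2)
  obtain ⟨z, hz, hz'⟩ := (h1.and self_mem_nhdsWithin).exists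
  exact hz hz'.1

/-- A real function has derivative zero at almost every one of its zeros at which it is
differentiable. -/
theorem ae_hasDerivAt_eq_zero_of_eq_zero (f : ℝ → ℝ) :
    ∀ᵐ t, ∀ d, HasDerivAt f d t → f t = 0 → d = 0 := by
  -- The exceptional set consists of zeros isolated from the right. Any other zero is a limit of
  -- zeros, which a nonzero derivative forbids.
  have hc : {t ∈ {s | f s = 0} | 𝓝[{s | f s = 0} ∩ Set.Ioi t] t = ⊥}.Countable :=
    countable_setOfPred_isolated_right_within
  filter_upwards [hc.ae_notMem volume] with t ht d hd h0
  exact hd.eq_zero_of_not_isolated fun h => ht ⟨h0, h⟩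

theorem exp_sub_one_le_mul_exp (x : ℝ) : Real.exp x - 1 ≤ x * Real.exp x := by
  have h := Real.add_one_le_exp (-x)
  have h1 : Real.exp (-x) * Real.exp x = 1 := by rw [← Real.exp_add]; simp
  nlinarith [Real.exp_pos x]

/-- First `sinh x ≤ x cosh x`, as the difference has derivative `x sinh x ≥ 0`; then `cosh x ≤
exp(x²/2)`. This Gaussian factor becomes the exponential in `condF`. -/
theorem sinh_le_mul_exp_half_sq {x : ℝ} (hx : 0 ≤ x) : Real.sinh x ≤ x * Real.exp (x ^ 2 / 2) := by
  have h : Real.sinh x ≤ x * Real.cosh x := by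
    have hmono : MonotoneOn (fun y => y * Real.cosh y - Real.sinh y) (Set.Ici 0) := by
      refine monotoneOn_of_deriv_nonneg (convex_Ici 0) (by fun_prop) (by fun_prop) fun y hy => ?_
      rw [interior_Ici] at hy
      have hd : HasDerivAt (fun y => y * Real.cosh y - Real.sinh y)
          (1 * Real.cosh y + y * Real.sinh y - Real.cosh y) y :=
        ((hasDerivAt_id y).mul (Real.hasDerivAt_cosh y)).sub (Real.hasDerivAt_sinh y)
      rw [hd.deriv]
      have := Real.sinh_nonneg_iff.2 (le_of_lt hy)
      have := mul_nonneg (le_of_lt hy) this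
      linarith
    have := hmono (Set.self_mem_Ici) hx hx
    simpa using this
  exact h.trans (mul_le_mul_of_nonneg_left (Real.cosh_le_exp_half_sq x) hx)

theorem cosh_sub_one_le {x : ℝ} (hx : 0 ≤ x) :
    Real.cosh x - 1 ≤ x ^ 2 / 2 * Real.exp (x ^ 2 / 2) := by
  have h1 : Real.cosh x - 1 = 2 * Real.sinh (x / 2) ^ 2 := by
    have := Real.cosh_two_mul (x / 2)
    rw [Real.cosh_sq (x / 2), mul_div_cancel₀ x two_ne_zero] at this
    linarith
  have h2 := sinh_le_mul_exp_half_sq (x := x / 2) (by positivity)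
  have h3 : 0 ≤ Real.sinh (x / 2) := Real.sinh_nonneg_iff.2 (by positivity)
  have h4 : Real.exp ((x / 2) ^ 2 / 2) ^ 2 ≤ Real.exp (x ^ 2 / 2) := by
    rw [← Real.exp_nat_mul]
    exact Real.exp_le_exp.2 (by push_cast; nlinarith [sq_nonneg x])
  calc Real.cosh x - 1 = 2 * Real.sinh (x / 2) ^ 2 := h1
    _ ≤ 2 * (x / 2 * Real.exp ((x / 2) ^ 2 / 2)) ^ 2 := by gcongr
    _ = x ^ 2 / 2 * Real.exp ((x / 2) ^ 2 / 2) ^ 2 := by ring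
    _ ≤ _ := by gcongr

/-- Comparison with the linear system `a' = ρ (v + b)`, `b' = ρ (w + a)`, `a(0) = b(0) = 0`. -/
theorem le_sinh_cosh_of_le_integral {A B ρ τ : ℝ → ℝ} {v w T : ℝ} (hT : 0 ≤ T)
    (hA : ContinuousOn A (Set.Icc 0 T)) (hB : ContinuousOn B (Set.Icc 0 T))
    (hρ : Continuous ρ) (hρ0 : ∀ s, 0 ≤ ρ s) (hτ : ∀ s, HasDerivAt τ (ρ s) s) (hτ0 : τ 0 = 0)
    (hA' : ∀ t ∈ Set.Icc 0 T, A t ≤ ∫ s in (0 : ℝ)..t, ρ s * (v + B s))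
    (hB' : ∀ t ∈ Set.Icc 0 T, B t ≤ ∫ s in (0 : ℝ)..t, ρ s * (w + A s)) :
    A T ≤ v * Real.sinh (τ T) + w * (Real.cosh (τ T) - 1) := by
  have hτc : Continuous τ := continuous_iff_continuousAt.2 fun s => (hτ s).continuousAt
  -- `a` and `b` solve the linear system exactly, in the time variable `τ`.
  obtain ⟨a, ha⟩ : ∃ a : ℝ → ℝ, a = fun s => v * Real.sinh (τ s) + w * (Real.cosh (τ s) - 1) :=
    ⟨_, rfl⟩
  obtain ⟨b, hb⟩ : ∃ b : ℝ → ℝ, b = fun s => w * Real.sinh (τ s) + v * (Real.cosh (τ s) - 1) :=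
    ⟨_, rfl⟩
  have hac : Continuous a := by rw [ha]; fun_prop
  have hbc : Continuous b := by rw [hb]; fun_prop
  have hai : ∀ t, a t = ∫ s in (0 : ℝ)..t, ρ s * (v + b s) := fun t => by
    have hd : ∀ s, HasDerivAt a (ρ s * (v + b s)) s := fun s => by
      rw [ha, hb]
      convert! (((hτ s).sinh).const_mul v).add ((((hτ s).cosh).sub_const 1).const_mul w) using 1
      ring
    rw [intervalIntegral.integral_eq_sub_of_hasDerivAt (fun s _ => hd s)
      (Continuous.intervalIntegrable (by fun_prop) _ _)]
    simp [ha, hτ0]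
  have hbi : ∀ t, b t = ∫ s in (0 : ℝ)..t, ρ s * (w + a s) := fun t => by
    have hd : ∀ s, HasDerivAt b (ρ s * (w + a s)) s := fun s => by
      rw [ha, hb]
      convert! (((hτ s).sinh).const_mul w).add ((((hτ s).cosh).sub_const 1).const_mul v) using 1
      ring
    rw [intervalIntegral.integral_eq_sub_of_hasDerivAt (fun s _ => hd s)
      (Continuous.intervalIntegrable (by fun_prop) _ _)]
    simp [hb, hτ0]
  obtain ⟨C, hC⟩ := (isCompact_Icc (a := (0 : ℝ)) (b := T)).bddAbove_image hρ.continuousOn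
  have hC' : ∀ s ∈ Set.Icc 0 T, ρ s ≤ C := fun s hs => hC ⟨s, hs, rfl⟩
  -- Clamping time to `[0,T]` makes the data continuous on the whole line, so that the primitive of
  -- the excess is differentiable everywhere.
  let P : ℝ → ℝ := fun s => (Set.projIcc 0 T hT s : ℝ)
  have hP : Continuous P := continuous_subtype_val.comp continuous_projIcc
  have hPm : ∀ s, P s ∈ Set.Icc 0 T := fun s => (Set.projIcc 0 T hT s).2
  have hPe : ∀ s ∈ Set.Icc 0 T, P s = s := fun s hs => by simp [P, Set.projIcc_of_mem hT hs]
  have hAP : Continuous fun s => A (P s) := hA.comp_continuous hP hPm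
  have hBP : Continuous fun s => B (P s) := hB.comp_continuous hP hPm
  -- The larger positive excess over the exact solution. It satisfies `e ≤ C ∫ e`, so Grönwall
  -- applied to `∫ e` forces it to vanish.
  obtain ⟨e, he⟩ : ∃ e : ℝ → ℝ, e = fun s => max (max (A (P s) - a s) (B (P s) - b s)) 0 :=
    ⟨_, rfl⟩
  have hec : Continuous e := by
    rw [he]; exact ((hAP.sub hac).max (hBP.sub hbc)).max continuous_const
  have he0 : ∀ s, 0 ≤ e s := fun s => by rw [he]; exact le_max_right _ _
  have bound : ∀ (f g f' g' : ℝ → ℝ) (k : ℝ), Continuous g → ContinuousOn g' (Set.Icc 0 T) →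
      (∀ t, f t = ∫ s in (0 : ℝ)..t, ρ s * (k + g s)) →
      (∀ t ∈ Set.Icc 0 T, f' t ≤ ∫ s in (0 : ℝ)..t, ρ s * (k + g' s)) →
      (∀ s ∈ Set.Icc 0 T, g' s - g s ≤ e s) → ∀ t ∈ Set.Icc 0 T,
      f' t - f t ≤ C * ∫ s in (0 : ℝ)..t, e s := by
    intro f g f' g' k hg hg' h1 h2 h3 t ht
    have hsub : Set.Icc 0 t ⊆ Set.Icc 0 T := Set.Icc_subset_Icc_right ht.2
    have i1 : IntervalIntegrable (fun s => ρ s * (k + g' s)) volume 0 t :=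
      ContinuousOn.intervalIntegrable (by
        rw [Set.uIcc_of_le ht.1]
        exact hρ.continuousOn.mul (continuousOn_const.add (hg'.mono hsub)))
    have i2 : IntervalIntegrable (fun s => ρ s * (k + g s)) volume 0 t :=
      Continuous.intervalIntegrable (by fun_prop) _ _
    calc f' t - f t ≤ (∫ s in (0 : ℝ)..t, ρ s * (k + g' s)) - ∫ s in (0 : ℝ)..t, ρ s * (k + g s) := by
          rw [h1 t]; linarith [h2 t ht]
      _ = ∫ s in (0 : ℝ)..t, (ρ s * (k + g' s) - ρ s * (k + g s)) :=
          (intervalIntegral.integral_sub i1 i2).symm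
      _ ≤ ∫ s in (0 : ℝ)..t, C * e s := by
          refine intervalIntegral.integral_mono_on ht.1 (i1.sub i2)
            (Continuous.intervalIntegrable (by fun_prop) _ _) fun s hs => ?_
          have q1 := mul_le_mul_of_nonneg_left (h3 s (hsub hs)) (hρ0 s)
          have q2 := mul_le_mul_of_nonneg_right (hC' s (hsub hs)) (he0 s)
          linarith
      _ = _ := by rw [intervalIntegral.integral_const_mul]
  have hE : ∀ t ∈ Set.Icc 0 T, e t ≤ C * ∫ s in (0 : ℝ)..t, e s := by
    intro t ht
    have hA1 : ∀ s ∈ Set.Icc 0 T, A s - a s ≤ e s := fun s hs => by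
      rw [he]; simp only [hPe s hs]; exact (le_max_left _ _).trans (le_max_left _ _)
    have hB1 : ∀ s ∈ Set.Icc 0 T, B s - b s ≤ e s := fun s hs => by
      rw [he]; simp only [hPe s hs]; exact (le_max_right _ _).trans (le_max_left _ _)
    have r1 := bound a b A B v hbc hB hai hA' hB1 t ht
    have r2 := bound b a B A w hac hA hbi hB' hA1 t ht
    have r3 : 0 ≤ C * ∫ s in (0 : ℝ)..t, e s :=
      mul_nonneg ((hρ0 0).trans (hC' 0 ⟨le_rfl, hT⟩))
        (intervalIntegral.integral_nonneg ht.1 fun s _ => he0 s)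
    rw [he]; simp only [hPe t ht] ; rw [← he]
    exact max_le (max_le r1 r2) r3
  have hg := norm_le_gronwallBound_of_norm_deriv_right_le (f := fun t => ∫ s in (0 : ℝ)..t, e s)
    (f' := e) (δ := 0) (K := C) (ε := 0) (a := 0) (b := T)
    (fun t _ => (hec.integral_hasStrictDerivAt 0 t).hasDerivAt.continuousAt.continuousWithinAt)
    (fun t _ => (hec.integral_hasStrictDerivAt 0 t).hasDerivAt.hasDerivWithinAt)
    (by simp) (fun t ht => by
      rw [Real.norm_of_nonneg (he0 t), Real.norm_of_nonneg
        (intervalIntegral.integral_nonneg ht.1 fun s _ => he0 s), add_zero]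
      exact hE t ⟨ht.1, ht.2.le⟩) T ⟨hT, le_rfl⟩
  rw [gronwallBound_ε0_δ0, norm_le_zero_iff] at hg
  have h1 := hE T ⟨hT, le_rfl⟩
  rw [hg, mul_zero] at h1
  have h2 : A T - a T ≤ e T := by
    rw [he]; simp only [hPe T ⟨hT, le_rfl⟩]; exact (le_max_left _ _).trans (le_max_left _ _)
  rw [ha] at h2
  simp only at h2
  linarith

/-! ### Clarke subdifferentials of locally Lipschitz functions -/

section Clarke

variable {E : Type*} [NormedAddCommGroup E] [InnerProductSpace ℝ E] [FiniteDimensional ℝ E]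

theorem norm_gradient_le_of_lipschitzOn {f : E → ℝ} {x : E} {s : Set E} (hs : s ∈ 𝓝 x)
    {K : NNReal} (h : LipschitzOnWith K f s) : ‖gradient f x‖ ≤ K := by
  rw [gradient, LinearIsometryEquiv.norm_map]
  exact norm_fderiv_le_of_lipschitzOn ℝ hs h

theorem mem_clarkeSubdifferential_of_tendsto {f : E → ℝ} {x g : E} {u : ℕ → E}
    (hu : ∀ n, DifferentiableAt ℝ f (u n)) (hx : Tendsto u atTop (𝓝 x))
    (hg : Tendsto (fun n => gradient f (u n)) atTop (𝓝 g)) : g ∈ clarkeSubdifferential f x :=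
  subset_convexHull ℝ _ ⟨u, hu, hx, hg⟩

/-- A closed convex set that contains the gradients at all points of differentiability near `x`
contains the Clarke subdifferential at `x`. -/
theorem clarkeSubdifferential_subset {f : E → ℝ} {x : E} {K : Set E} (hK : IsClosed K)
    (hKc : Convex ℝ K) (h : ∀ᶠ u in 𝓝 x, DifferentiableAt ℝ f u → gradient f u ∈ K) :
    clarkeSubdifferential f x ⊆ K := by
  refine convexHull_min ?_ hKc
  rintro g ⟨u, hu, hx, hg⟩
  exact hK.mem_of_tendsto hg ((hx.eventually h).mono fun n hn => hn (hu n))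

theorem LocallyLipschitz.exists_tendsto_gradient {f : E → ℝ} (hf : LocallyLipschitz f) {x : E}
    {u : ℕ → E} (hx : Tendsto u atTop (𝓝 x)) :
    ∃ g, ∃ φ : ℕ → ℕ, StrictMono φ ∧ Tendsto (fun n => gradient f (u (φ n))) atTop (𝓝 g) := by
  obtain ⟨K, t, ht, hK⟩ := hf x
  have h1 : ∀ᶠ n in atTop, gradient f (u n) ∈ Metric.closedBall (0 : E) K := by
    filter_upwards [hx.eventually (eventually_mem_nhds_iff.2 ht)] with n hn
    simpa using norm_gradient_le_of_lipschitzOn hn hK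
  obtain ⟨g, -, φ, hφ, hg⟩ := (isCompact_closedBall (0 : E) K).tendsto_subseq' h1.frequently
  exact ⟨g, φ, hφ, hg⟩

theorem LocallyLipschitz.exists_eventually_norm_clarkeSubdifferential_le {f : E → ℝ}
    (hf : LocallyLipschitz f) (x : E) :
    ∃ M : ℝ, ∀ᶠ y in 𝓝 x, ∀ g ∈ clarkeSubdifferential f y, ‖g‖ ≤ M := by
  obtain ⟨K, t, ht, hK⟩ := hf x
  refine ⟨K, ?_⟩
  filter_upwards [eventually_eventually_nhds.2 (eventually_mem_nhds_iff.2 ht)] with y hy g hg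
  have := clarkeSubdifferential_subset (f := f) (x := y) (K := Metric.closedBall (0 : E) K)
    Metric.isClosed_closedBall (convex_closedBall _ _)
    (hy.mono fun u hu _ => by simpa using norm_gradient_le_of_lipschitzOn hu hK) hg
  simpa using this

theorem LocallyLipschitz.exists_norm_clarkeSubdifferential_le {f : E → ℝ}
    (hf : LocallyLipschitz f) {S : Set E} (hS : IsCompact S) :
    ∃ M : ℝ, 0 ≤ M ∧ ∀ y ∈ S, ∀ g ∈ clarkeSubdifferential f y, ‖g‖ ≤ M := by
  refine hS.induction_on (p := fun S => ∃ M : ℝ, 0 ≤ M ∧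
    ∀ y ∈ S, ∀ g ∈ clarkeSubdifferential f y, ‖g‖ ≤ M) ⟨0, le_rfl, by simp⟩ ?_ ?_ ?_
  · rintro s t hst ⟨M, h0, hM⟩
    exact ⟨M, h0, fun y hy => hM y (hst hy)⟩
  · rintro s t ⟨M, h0, hM⟩ ⟨M', h0', hM'⟩
    refine ⟨max M M', h0.trans (le_max_left _ _), fun y hy g hg => ?_⟩
    rcases hy with hy | hy
    · exact (hM y hy g hg).trans (le_max_left _ _)
    · exact (hM' y hy g hg).trans (le_max_right _ _)
  · intro x _
    obtain ⟨M, hM⟩ := hf.exists_eventually_norm_clarkeSubdifferential_le x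
    exact ⟨_, mem_nhdsWithin_of_mem_nhds hM, max M 0, le_max_right _ _,
      fun y hy g hg => (hy g hg).trans (le_max_left _ _)⟩

/-- Rademacher: the points of non-differentiability near `x` form a null set, and a neighbourhood
has positive measure. -/
theorem LocallyLipschitz.frequently_differentiableAt {f : E → ℝ} (hf : LocallyLipschitz f)
    (x : E) : ∃ᶠ u in 𝓝 x, DifferentiableAt ℝ f u := by
  let _ : MeasurableSpace E := borel E
  have : BorelSpace E := ⟨rfl⟩
  obtain ⟨K, t, ht, hK⟩ := hf x
  intro h
  have h1 : {u | ¬ DifferentiableAt ℝ f u} ∩ interior t ∈ 𝓝 x :=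
    inter_mem h (interior_mem_nhds.2 ht)
  have h2 : ∀ᵐ u ∂(Measure.addHaar : Measure E),
      u ∉ {u | ¬ DifferentiableAt ℝ f u} ∩ interior t := by
    filter_upwards [hK.ae_differentiableWithinAt_of_mem (μ := Measure.addHaar)] with u hu hu'
    exact hu'.1 ((hu (interior_subset hu'.2)).differentiableAt (mem_interior_iff_mem_nhds.1 hu'.2))
  exact (Measure.measure_pos_of_mem_nhds _ h1).ne' (measure_eq_zero_iff_ae_notMem.2 h2)

theorem LocallyLipschitz.clarkeSubdifferential_nonempty {f : E → ℝ} (hf : LocallyLipschitz f)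
    (x : E) : (clarkeSubdifferential f x).Nonempty := by
  obtain ⟨u, hu, hd⟩ := exists_seq_forall_of_frequently (hf.frequently_differentiableAt x)
  obtain ⟨g, φ, hφ, hg⟩ := hf.exists_tendsto_gradient hu
  exact ⟨g, mem_clarkeSubdifferential_of_tendsto (fun n => hd (φ n)) (hu.comp hφ.tendsto_atTop) hg⟩

/-- Upper semicontinuity of the Clarke subdifferential. -/
theorem LocallyLipschitz.eventually_clarkeSubdifferential_subset {f : E → ℝ}
    (hf : LocallyLipschitz f) (x : E) {ε : ℝ} (hε : 0 < ε) :
    ∀ᶠ y in 𝓝 x, clarkeSubdifferential f y ⊆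
      Metric.cthickening ε (clarkeSubdifferential f x) := by
  have key : ∀ᶠ u in 𝓝 x, DifferentiableAt ℝ f u →
      gradient f u ∈ Metric.cthickening ε (clarkeSubdifferential f x) := by
    -- Otherwise gradients outside the thickening occur along a sequence tending to `x`. They are
    -- bounded, and any subsequential limit lies in the subdifferential at `x`.
    by_contra hcon
    rw [not_eventually] at hcon
    obtain ⟨u, hu, hd⟩ := exists_seq_forall_of_frequently hcon
    obtain ⟨g, φ, hφ, hg⟩ := hf.exists_tendsto_gradient hu
    have hd' : ∀ n, DifferentiableAt ℝ f (u n) := fun n => by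
      by_contra h; exact hd n fun h' => absurd h' h
    have hm := mem_clarkeSubdifferential_of_tendsto (fun n => hd' (φ n))
      (hu.comp hφ.tendsto_atTop) hg
    obtain ⟨n, hn⟩ := (hg.eventually (Metric.ball_mem_nhds g hε)).exists
    exact hd (φ n) fun _ => Metric.mem_cthickening_of_dist_le _ _ _ _ hm (le_of_lt hn)
  filter_upwards [eventually_eventually_nhds.2 key] with y hy
  exact clarkeSubdifferential_subset Metric.isClosed_cthickening
    ((convex_convexHull ℝ _).cthickening ε) hy

end Clarke

/-! ### Regularity of solutions of the differential inclusion -/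

section Solution

variable {E : Type*} [NormedAddCommGroup E] [InnerProductSpace ℝ E]

theorem IsArcOn.continuousOn [CompleteSpace E] {T t : ℝ} {x : ℝ → E} (h : IsArcOn (Set.Ico 0 T) x)
    (ht : t ∈ Set.Ico 0 T) : ContinuousOn x (Set.Icc 0 t) := by
  obtain ⟨v, hv⟩ := h
  have h1 := intervalIntegral.continuousOn_primitive_interval' (hv t ht).1 Set.left_mem_uIcc
  rw [Set.uIcc_of_le ht.1] at h1
  refine (h1.add (continuousOn_const (c := x 0))).congr fun s hs => ?_
  change x s = (∫ r in (0 : ℝ)..s, v r) + x 0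
  rw [← (hv s ⟨hs.1, hs.2.trans_lt ht.2⟩).2]; abel

variable [FiniteDimensional ℝ E]

theorem isArcOn_of_lipschitzOnWith {I : Set ℝ} {x : ℝ → E}
    (h : ∀ t ∈ I, 0 ≤ t ∧ ∃ K, LipschitzOnWith K x (Set.Icc 0 t)) : IsArcOn I x := by
  refine ⟨deriv x, fun t ht => ?_⟩
  obtain ⟨h0, K, hK⟩ := h t ht
  exact ⟨hK.intervalIntegrable_deriv h0, (hK.intervalIntegral_deriv_eq_sub h0).symm⟩

theorem IsSolutionOn.mono {f : E → ℝ} {x₀ : E} {I J : Set ℝ} {x : ℝ → E}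
    (h : IsSolutionOn f x₀ I x) (hJ : J ⊆ I) : IsSolutionOn f x₀ J x := by
  obtain ⟨h0, ⟨v, hv⟩, h2⟩ := h
  exact ⟨h0, ⟨v, fun t ht => hv t (hJ ht)⟩, ae_restrict_of_ae_restrict_of_subset hJ h2⟩

theorem IsSolutionOn.ae_Ioo {f : E → ℝ} {x₀ : E} {T t : ℝ} {x : ℝ → E}
    (h : IsSolutionOn f x₀ (Set.Ico 0 T) x) (ht : t ≤ T) :
    ∀ᵐ s, s ∈ Set.Ioo 0 t → ∃ w : E, HasDerivAt x w s ∧ -w ∈ clarkeSubdifferential f (x s) := by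
  filter_upwards [(ae_restrict_iff' measurableSet_Ico).1 h.2.2] with s hs hs'
  exact hs ⟨hs'.1.le, hs'.2.trans_le ht⟩

/-- The density `v` of the arc is almost everywhere its derivative, hence minus a subgradient, and
so is bounded by `M`. -/
theorem IsSolutionOn.lipschitzOnWith {f : E → ℝ} {x₀ : E} {T t : ℝ} {x : ℝ → E} {M : NNReal}
    (h : IsSolutionOn f x₀ (Set.Ico 0 T) x) (ht : t ∈ Set.Ico 0 T)
    (hM : ∀ s ∈ Set.Icc 0 t, ∀ g ∈ clarkeSubdifferential f (x s), ‖g‖ ≤ M) :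
    LipschitzOnWith M x (Set.Icc 0 t) := by
  have hae := h.ae_Ioo ht.2.le
  obtain ⟨h0, ⟨v, hv⟩, h2⟩ := h
  have hv' : ∀ᵐ s, s ∈ Set.Ioo 0 t → ‖v s‖ ≤ M := by
    filter_upwards [hae, (hv t ht).1.ae_hasDerivAt_integral] with s hs hs1 hst
    obtain ⟨w, hw, hw'⟩ := hs hst
    have h3 := hs1 (by rw [Set.uIcc_of_le ht.1]; exact Set.Ioo_subset_Icc_self hst) 0
      Set.left_mem_uIcc
    have h4 : HasDerivAt x (v s) s := by
      refine (h3.const_add (x 0)).congr_of_eventuallyEq ?_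
      filter_upwards [Ioo_mem_nhds hst.1 hst.2] with r hr
      rw [← (hv r ⟨hr.1.le, hr.2.trans ht.2⟩).2]; abel
    rw [h4.unique hw, ← norm_neg]
    exact hM s (Set.Ioo_subset_Icc_self hst) _ hw'
  have h5 := lipschitzOnWith_intervalIntegral ht.1 (hv t ht).1 hv'
  intro r hr s hs
  have h6 := h5 hr hs
  simp only at h6
  rw [← (hv r ⟨hr.1, hr.2.trans_lt ht.2⟩).2, ← (hv s ⟨hs.1, hs.2.trans_lt ht.2⟩).2] at h6
  simpa using h6

theorem IsSolutionOn.exists_lipschitzOnWith {f : E → ℝ} (hf : LocallyLipschitz f) {x₀ : E}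
    {T t : ℝ} {x : ℝ → E} (h : IsSolutionOn f x₀ (Set.Ico 0 T) x) (ht : t ∈ Set.Ico 0 T) :
    ∃ K, LipschitzOnWith K x (Set.Icc 0 t) := by
  obtain ⟨M, hM0, hM⟩ := hf.exists_norm_clarkeSubdifferential_le
    (isCompact_Icc.image_of_continuousOn (h.2.1.continuousOn ht))
  exact ⟨⟨M, hM0⟩, h.lipschitzOnWith ht fun s hs => hM _ ⟨s, hs, rfl⟩⟩

end Solution

/-! ### Euler schemes and their limits -/

section Euler

variable {E : Type*} [NormedAddCommGroup E] [NormedSpace ℝ E]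

/-- The explicit Euler scheme with step `h` for the equation `y' = G(t, y)`, `y(0) = x₀`. -/
noncomputable def eulerSeq (G : ℝ → E → E) (x₀ : E) (h : ℝ) : ℕ → E
  | 0 => x₀
  | k + 1 => eulerSeq G x₀ h k + h • G (k * h) (eulerSeq G x₀ h k)

theorem eulerSeq_sub (G : ℝ → E → E) (x₀ : E) (h : ℝ) {i j : ℕ} (hij : i ≤ j) :
    eulerSeq G x₀ h j - eulerSeq G x₀ h i =
      h • ∑ k ∈ Finset.Ico i j, G (k * h) (eulerSeq G x₀ h k) := by
  induction j, hij using Nat.le_induction with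
  | base => simp
  | succ j hij ih =>
    rw [Finset.sum_Ico_succ_top hij, smul_add, ← ih, eulerSeq]
    abel

theorem norm_eulerSeq_sub_le {G : ℝ → E → E} {x₀ : E} {h M : ℝ} (hh : 0 ≤ h) {i j : ℕ}
    (hij : i ≤ j) (hM : ∀ k : ℕ, k < j → ∀ y, ‖G (k * h) y‖ ≤ M) :
    ‖eulerSeq G x₀ h j - eulerSeq G x₀ h i‖ ≤ M * (j * h - i * h) := by
  rw [eulerSeq_sub G x₀ h hij, norm_smul, Real.norm_of_nonneg hh]
  have h1 : ‖∑ k ∈ Finset.Ico i j, G (k * h) (eulerSeq G x₀ h k)‖ ≤ (j - i : ℕ) * M := by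
    refine (norm_sum_le_of_le _ fun k hk => hM k (Finset.mem_Ico.1 hk).2 _).trans ?_
    simp
  rw [Nat.cast_sub hij] at h1
  nlinarith [mul_le_mul_of_nonneg_left h1 hh]

/-- An increment of the scheme divided by elapsed time is an average of field values, so convexity
keeps it in `K`. This passes the inclusion to the limit without weak convergence of derivatives. -/
theorem eulerSeq_sub_mem_smul {G : ℝ → E → E} {x₀ : E} {h : ℝ} {K : Set E} (hK : Convex ℝ K)
    {i j : ℕ} (hij : i < j)
    (hG : ∀ k ∈ Finset.Ico i j, G (k * h) (eulerSeq G x₀ h k) ∈ K) :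
    ∃ g ∈ K, eulerSeq G x₀ h j - eulerSeq G x₀ h i = (j * h - i * h) • g := by
  have hpos : (0 : ℝ) < (j : ℝ) - i := sub_pos.2 (by exact_mod_cast hij)
  refine ⟨∑ k ∈ Finset.Ico i j, ((j : ℝ) - i)⁻¹ • G (k * h) (eulerSeq G x₀ h k),
    hK.sum_mem (fun _ _ => by positivity) ?_ hG, ?_⟩
  · rw [Finset.sum_const, Nat.card_Ico, nsmul_eq_mul, Nat.cast_sub hij.le]
    exact mul_inv_cancel₀ hpos.ne'
  · rw [eulerSeq_sub G x₀ h hij.le, ← Finset.smul_sum, smul_smul]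
    congr 1
    field_simp

/-- The Euler scheme with step `1 / (n + 1)`, as a step function of time. -/
noncomputable def eulerStep (G : ℝ → E → E) (x₀ : E) (n : ℕ) (t : ℝ) : E :=
  eulerSeq G x₀ (1 / (n + 1)) ⌊t * (n + 1)⌋₊

theorem floor_mul_le {t : ℝ} (ht : 0 ≤ t) (n : ℕ) :
    (⌊t * (n + 1)⌋₊ : ℝ) * (1 / (n + 1)) ≤ t := by
  have h := Nat.floor_le (a := t * (n + 1)) (by positivity)
  rw [mul_one_div, div_le_iff₀ (by positivity)]
  exact h

theorem lt_floor_mul (t : ℝ) (n : ℕ) :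
    t - 1 / (n + 1) < (⌊t * (n + 1)⌋₊ : ℝ) * (1 / (n + 1)) := by
  have h := Nat.lt_floor_add_one (t * ((n : ℝ) + 1))
  have hn : (0 : ℝ) < n + 1 := by positivity
  rw [mul_one_div, lt_div_iff₀ hn, sub_mul, one_div_mul_cancel hn.ne']
  linarith

theorem tendsto_floor_mul (t : ℝ) (ht : 0 ≤ t) :
    Tendsto (fun n : ℕ => (⌊t * (n + 1)⌋₊ : ℝ) * (1 / (n + 1))) atTop (𝓝 t) := by
  refine tendsto_of_tendsto_of_tendsto_of_le_of_le (g := fun n : ℕ => t - 1 / ((n : ℝ) + 1))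
    (h := fun _ => t) ?_ tendsto_const_nhds (fun n => (lt_floor_mul t n).le)
    (fun n => floor_mul_le ht n)
  simpa using (tendsto_const_nhds (x := t)).sub (tendsto_one_div_add_atTop_nhds_zero_nat (𝕜 := ℝ))

theorem norm_eulerStep_sub_le {G : ℝ → E → E} {x₀ : E} {M s t : ℝ} {n : ℕ} (hs : 0 ≤ s)
    (hst : s ≤ t) (hM0 : 0 ≤ M) (hM : ∀ r ≤ t, ∀ y, ‖G r y‖ ≤ M) :
    ‖eulerStep G x₀ n t - eulerStep G x₀ n s‖ ≤ M * (t - s + 1 / (n + 1)) := by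
  have h1 : ⌊s * ((n : ℝ) + 1)⌋₊ ≤ ⌊t * ((n : ℝ) + 1)⌋₊ :=
    Nat.floor_le_floor (by gcongr)
  have h2 := floor_mul_le (hs.trans hst) n
  have h3 := lt_floor_mul s n
  refine (norm_eulerSeq_sub_le (M := M) (by positivity) h1 fun k hk y => hM _ ?_ y).trans ?_
  · refine le_trans ?_ h2
    gcongr
  · refine mul_le_mul_of_nonneg_left ?_ hM0
    linarith

/-- A pointwise limit of Euler schemes solves the differential inclusion wherever it is
differentiable, if the field is a selection of an upper semicontinuous map with closed convex
values. -/
theorem mem_of_hasDerivAt_of_tendsto_eulerStep {F : Filter ℕ} [NeBot F] (hF : F ≤ atTop)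
    {G : ℝ → E → E} {Φ : E → Set E} {x₀ : E} {x : ℝ → E} {M t : ℝ} {w : E}
    (ht : 0 < t) (hM0 : 0 ≤ M) (hM : ∀ r ≤ t + 1, ∀ y, ‖G r y‖ ≤ M)
    (hx : ∀ s, 0 ≤ s → Tendsto (fun n => eulerStep G x₀ n s) F (𝓝 (x s)))
    (hc : IsClosed (Φ (x t)))
    (hconv : Convex ℝ (Φ (x t)))
    (husc : ∀ ε > 0, ∃ δ > 0, ∀ s y, t - δ < s → ‖y - x t‖ < δ →
      G s y ∈ Metric.cthickening ε (Φ (x t)))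
    (hw : HasDerivAt x w t) : w ∈ Φ (x t) := by
  rw [← hc.closure_eq, Metric.closure_eq_iInter_cthickening]
  simp only [Set.mem_iInter]
  intro ε hε
  obtain ⟨δ, hδ, hG⟩ := husc ε hε
  have hKc : IsClosed (Metric.cthickening ε (Φ (x t))) := Metric.isClosed_cthickening
  have hKv : Convex ℝ (Metric.cthickening ε (Φ (x t))) := hconv.cthickening ε
  generalize Metric.cthickening ε (Φ (x t)) = K at hG hKc hKv
  have hh : Tendsto (fun n : ℕ => 1 / ((n : ℝ) + 1)) F (𝓝 0) :=
    tendsto_one_div_add_atTop_nhds_zero_nat.mono_left hF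
  -- On a short interval after `t` the scheme stays within `δ` of `x t`: one third for its error at
  -- `t`, one third for its motion. All field values used then lie in `K`, and so does the limiting
  -- difference quotient.
  have hslope : ∀ r : ℝ, 0 < r → r < 1 → M * r < δ / 3 → r⁻¹ • (x (t + r) - x t) ∈ K := by
    intro r hr hr1 hrδ
    have hd : Tendsto (fun n : ℕ => (⌊(t + r) * ((n : ℝ) + 1)⌋₊ : ℝ) * (1 / (n + 1)) -
        (⌊t * ((n : ℝ) + 1)⌋₊ : ℝ) * (1 / (n + 1))) F (𝓝 r) := by
      have := ((tendsto_floor_mul (t + r) (by linarith)).sub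
        (tendsto_floor_mul t ht.le)).mono_left hF
      simpa using this
    have hlim := (hd.inv₀ hr.ne').smul ((hx (t + r) (by linarith)).sub (hx t ht.le))
    refine hKc.mem_of_tendsto hlim ?_
    have e1 : ∀ᶠ n in F, ‖eulerStep G x₀ n t - x t‖ < δ / 3 := by
      have := (hx t ht.le).eventually (Metric.ball_mem_nhds (x t) (by positivity : 0 < δ / 3))
      simpa [dist_eq_norm] using this
    have e2 : ∀ᶠ n : ℕ in F, 1 / ((n : ℝ) + 1) < δ := hh.eventually (gt_mem_nhds hδ)
    have e3 : ∀ᶠ n : ℕ in F, 0 < (⌊(t + r) * ((n : ℝ) + 1)⌋₊ : ℝ) * (1 / (n + 1)) -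
        (⌊t * ((n : ℝ) + 1)⌋₊ : ℝ) * (1 / (n + 1)) := hd.eventually (lt_mem_nhds hr)
    have e4 : ∀ᶠ n : ℕ in F, M * (r + 1 / ((n : ℝ) + 1)) < δ / 3 := by
      have : Tendsto (fun n : ℕ => M * (r + 1 / ((n : ℝ) + 1))) F (𝓝 (M * (r + 0))) :=
        (hh.const_add r).const_mul M
      rw [add_zero] at this
      exact this.eventually (gt_mem_nhds hrδ)
    filter_upwards [e1, e2, e3, e4] with n h1 h2 h3 h4
    have hn : (0 : ℝ) < 1 / ((n : ℝ) + 1) := by positivity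
    have hij : ⌊t * ((n : ℝ) + 1)⌋₊ < ⌊(t + r) * ((n : ℝ) + 1)⌋₊ := by
      rw [← sub_mul] at h3
      have := (mul_pos_iff_of_pos_right hn).1 h3
      exact_mod_cast sub_pos.1 this
    have hfl := floor_mul_le (t := t + r) (by linarith) n
    obtain ⟨g, hg, he⟩ := eulerSeq_sub_mem_smul (G := G) (x₀ := x₀) (h := 1 / ((n : ℝ) + 1))
      hKv hij fun k hk => by
        rw [Finset.mem_Ico] at hk
        have hkr : (k : ℝ) * (1 / ((n : ℝ) + 1)) ≤
            (⌊(t + r) * ((n : ℝ) + 1)⌋₊ : ℝ) * (1 / (n + 1)) := by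
          have : (k : ℝ) ≤ ⌊(t + r) * ((n : ℝ) + 1)⌋₊ := by exact_mod_cast hk.2.le
          gcongr
        have hkl : (⌊t * ((n : ℝ) + 1)⌋₊ : ℝ) * (1 / (n + 1)) ≤
            (k : ℝ) * (1 / ((n : ℝ) + 1)) := by
          have : (⌊t * ((n : ℝ) + 1)⌋₊ : ℝ) ≤ k := by exact_mod_cast hk.1
          gcongr
        have hlt := lt_floor_mul t n
        refine hG _ _ (by linarith) ?_
        have h5 := norm_eulerSeq_sub_le (G := G) (x₀ := x₀) (M := M) hn.le hk.1
          fun l hl y => hM _ (by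
            have : (l : ℝ) ≤ k := by exact_mod_cast hl.le
            have : (l : ℝ) * (1 / ((n : ℝ) + 1)) ≤ k * (1 / ((n : ℝ) + 1)) := by gcongr
            linarith) y
        have h6 : M * ((k : ℝ) * (1 / ((n : ℝ) + 1)) -
            (⌊t * ((n : ℝ) + 1)⌋₊ : ℝ) * (1 / (n + 1))) ≤ M * (r + 1 / ((n : ℝ) + 1)) :=
          mul_le_mul_of_nonneg_left (by linarith) hM0
        have h7 := norm_sub_le_norm_sub_add_norm_sub
          (eulerSeq G x₀ (1 / ((n : ℝ) + 1)) k) (eulerStep G x₀ n t) (x t)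
        have h8 : ‖eulerSeq G x₀ (1 / ((n : ℝ) + 1)) k - eulerStep G x₀ n t‖ < δ / 3 :=
          (h5.trans h6).trans_lt h4
        linarith
    rw [eulerStep, eulerStep, he, smul_smul, inv_mul_cancel₀ h3.ne', one_smul]
    exact hg
  have hsl : Tendsto (fun r : ℝ => r⁻¹ • (x (t + r) - x t)) (𝓝[>] 0) (𝓝 w) :=
    (hasDerivAt_iff_tendsto_slope_zero.1 hw).mono_left
      (nhdsWithin_mono _ fun r (hr : 0 < r) => ne_of_gt hr)
  refine hKc.mem_of_tendsto hsl ?_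
  have c1 : ∀ᶠ r : ℝ in 𝓝[>] 0, r < 1 := nhdsWithin_le_nhds (gt_mem_nhds one_pos)
  have c2 : ∀ᶠ r : ℝ in 𝓝[>] 0, M * r < δ / 3 := by
    have : Tendsto (fun r : ℝ => M * r) (𝓝[>] 0) (𝓝 (M * 0)) :=
      (tendsto_id.const_mul M).mono_left nhdsWithin_le_nhds
    rw [mul_zero] at this
    exact this.eventually (gt_mem_nhds (by positivity))
  filter_upwards [c1, c2, self_mem_nhdsWithin] with r h1 h2 h3
  exact hslope r h3 h1 h2

end Euler

/-! ### Global existence and extension of solutions -/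

section Existence

variable {E : Type*} [NormedAddCommGroup E] [InnerProductSpace ℝ E] [FiniteDimensional ℝ E]

theorem LipschitzOnWith.ae_exists_hasDerivAt_of_forall {x : ℝ → E}
    (h : ∀ t, 0 ≤ t → ∃ K, LipschitzOnWith K x (Set.Icc 0 t)) :
    ∀ᵐ t, 0 < t → DifferentiableAt ℝ x t := by
  have h1 : ∀ n : ℕ, ∀ᵐ t, t ∈ Set.Ioo (0 : ℝ) n → DifferentiableAt ℝ x t := fun n => by
    obtain ⟨K, hK⟩ := h n (by positivity)
    exact hK.ae_differentiableAt_Ioo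
  filter_upwards [ae_all_iff.2 h1] with t ht h0
  obtain ⟨n, hn⟩ := exists_nat_gt t
  exact ht n ⟨h0, hn⟩

/-- Global existence for the subgradient flow of a locally Lipschitz function whose solutions
satisfy an a priori bound. -/
theorem exists_isSolutionOn_Ici {f : E → ℝ} (hf : LocallyLipschitz f)
    (hcl : ∀ x, IsClosed (clarkeSubdifferential f x)) (x₀ : E) {c : ℝ} (hc : 0 ≤ c)
    (hbound : ∀ T, 0 < T → ∀ x : ℝ → E, IsSolutionOn f x₀ (Set.Ico 0 T) x →
      ∀ t ∈ Set.Ico 0 T, ‖x t - x₀‖ ≤ c + t) :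
    ∃ x : ℝ → E, IsSolutionOn f x₀ (Set.Ici 0) x ∧
      ∀ t, 0 ≤ t → ∃ K, LipschitzOnWith K x (Set.Icc 0 t) := by
  classical
  choose sel hsel using hf.clarkeSubdifferential_nonempty
  -- The cut-off bounds the field on bounded times; its radius exceeds the a priori bound by one.
  -- Since it grows with time, a point inside remains inside at all later times, as the one-sided
  -- condition in `mem_of_hasDerivAt_of_tendsto_eulerStep` requires.
  let G : ℝ → E → E := fun t y => if ‖y - x₀‖ < c + 1 + t then -sel y else 0
  have hG : ∀ τ, ∃ M, 0 ≤ M ∧ ∀ t ≤ τ, ∀ y, ‖G t y‖ ≤ M := fun τ => by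
    obtain ⟨M, hM0, hM⟩ := hf.exists_norm_clarkeSubdifferential_le
      (isCompact_closedBall x₀ (c + 1 + τ))
    refine ⟨M, hM0, fun t ht y => ?_⟩
    by_cases h : ‖y - x₀‖ < c + 1 + t
    · simp only [G, if_pos h, norm_neg]
      exact hM y (by rw [Metric.mem_closedBall, dist_eq_norm]; linarith) _ (hsel y)
    · simpa only [G, if_neg h, norm_zero] using hM0
  choose M hM0 hM using hG
  -- A fixed nonprincipal ultrafilter gives the limit at every time at once, with no diagonal
  -- subsequence.
  have hlim : ∀ t, ∃ y, 0 ≤ t → Tendsto (fun n => eulerStep G x₀ n t)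
      (hyperfilter ℕ : Filter ℕ) (𝓝 y) := fun t => by
    by_cases ht : 0 ≤ t
    swap
    · exact ⟨0, fun h => absurd h ht⟩
    obtain ⟨y, -, hy⟩ := (isCompact_closedBall x₀ (M t * (t + 1))).ultrafilter_le_nhds
      ((hyperfilter ℕ).map fun n => eulerStep G x₀ n t) (by
        rw [le_principal_iff]
        refine mem_map.2 (univ_mem' fun n => ?_)
        have h1 := norm_eulerStep_sub_le (x₀ := x₀) (n := n) le_rfl ht (hM0 t) (hM t)
        have h2 : eulerStep G x₀ n 0 = x₀ := by simp [eulerStep, eulerSeq]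
        have h3 : 1 / ((n : ℝ) + 1) ≤ 1 := by
          rw [div_le_one (by positivity)]; linarith [n.cast_nonneg (α := ℝ)]
        rw [h2] at h1
        simp only [Set.mem_preimage, Metric.mem_closedBall, dist_eq_norm]
        exact h1.trans (mul_le_mul_of_nonneg_left (by linarith) (hM0 t)))
    exact ⟨y, fun _ => hy⟩
  choose x hx using hlim
  have hF : ((hyperfilter ℕ : Ultrafilter ℕ) : Filter ℕ) ≤ atTop := by
    rw [← Nat.cofinite_eq_atTop]; exact hyperfilter_le_cofinite
  have hx0 : x 0 = x₀ := by
    refine tendsto_nhds_unique (hx 0 le_rfl) ?_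
    simp [eulerStep, eulerSeq]
  have hlip : ∀ t, 0 ≤ t → LipschitzOnWith (NNReal.mk (M t) (hM0 t)) x (Set.Icc 0 t) := by
    intro t ht
    have key : ∀ r ∈ Set.Icc 0 t, ∀ s ∈ Set.Icc 0 t, r ≤ s →
        ‖x s - x r‖ ≤ M t * (s - r) := by
      intro r hr s hs hrs
      have l1 := ((hx s hs.1).sub (hx r hr.1)).norm
      have l2 : Tendsto (fun n : ℕ => M t * (s - r + 1 / ((n : ℝ) + 1)))
          (hyperfilter ℕ : Filter ℕ) (𝓝 (M t * (s - r + 0))) :=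
        ((tendsto_one_div_add_atTop_nhds_zero_nat.mono_left hF).const_add (s - r)).const_mul (M t)
      rw [add_zero] at l2
      exact le_of_tendsto_of_tendsto' l1 l2 fun n => norm_eulerStep_sub_le hr.1 hrs (hM0 t)
        fun q hq => hM t q (hq.trans hs.2)
    refine LipschitzOnWith.of_dist_le_mul fun r hr s hs => ?_
    rw [dist_eq_norm, Real.dist_eq, NNReal.coe_mk]
    rcases le_total r s with h | h
    · rw [norm_sub_rev, abs_sub_comm, abs_of_nonneg (by linarith)]
      exact key r hr s hs h
    · rw [abs_of_nonneg (by linarith)]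
      exact key s hs r hr h
  have hlip' : ∀ t, 0 ≤ t → ∃ K, LipschitzOnWith K x (Set.Icc 0 t) := fun t ht => ⟨_, hlip t ht⟩
  have hcont : ContinuousOn x (Set.Ici 0) := fun t ht => by
    refine ((hlip (t + 1) (by linarith [Set.mem_Ici.1 ht])).continuousOn t
      ⟨ht, by linarith⟩).mono_of_mem_nhdsWithin ?_
    rw [← Set.Ici_inter_Iic]
    exact inter_mem self_mem_nhdsWithin (mem_nhdsWithin_of_mem_nhds (Iic_mem_nhds (by linarith)))
  have hincl : ∀ t, 0 < t → ‖x t - x₀‖ < c + 1 + t → ∀ w, HasDerivAt x w t →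
      -w ∈ clarkeSubdifferential f (x t) := by
    intro t ht hR w hw
    have hmem := mem_of_hasDerivAt_of_tendsto_eulerStep (F := (hyperfilter ℕ : Filter ℕ)) hF
      (G := G) (Φ := fun y => -clarkeSubdifferential f y) ht (hM0 (t + 1)) (hM (t + 1))
      hx (hcl (x t)).neg (convex_convexHull ℝ _).neg ?_ hw
    · exact hmem
    intro ε hε
    obtain ⟨δ, hδ, hs⟩ := Metric.eventually_nhds_iff.1
      (hf.eventually_clarkeSubdifferential_subset (x t) hε)
    -- Half of the margin to the cut-off absorbs the change of position, half the change of time, so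
    -- the field equals `-sel` here.
    refine ⟨min δ ((c + 1 + t - ‖x t - x₀‖) / 2), lt_min hδ (by linarith), fun s y hs1 hy => ?_⟩
    have hy1 := hy.trans_le (min_le_left _ _)
    have hy2 := hy.trans_le (min_le_right _ _)
    have hs2 := min_le_right δ ((c + 1 + t - ‖x t - x₀‖) / 2)
    have htri := norm_sub_le_norm_sub_add_norm_sub y (x t) x₀
    have hlt : ‖y - x₀‖ < c + 1 + s := by linarith
    simp only [G, if_pos hlt]
    have h1 := hs (by rwa [dist_eq_norm] : dist y (x t) < δ) (hsel y)
    rw [Metric.mem_cthickening_iff] at h1 ⊢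
    have h2 := Metric.infEDist_image (IsometryEquiv.neg E).isometry (x := sel y)
      (t := clarkeSubdifferential f (x t))
    rw [← h2] at h1
    simpa using h1
  have hae := LipschitzOnWith.ae_exists_hasDerivAt_of_forall hlip'
  have hsol : ∀ T, 0 < T → (∀ t ∈ Set.Ico 0 T, ‖x t - x₀‖ < c + 1 + t) →
      IsSolutionOn f x₀ (Set.Ico 0 T) x := by
    intro T hT hR
    refine ⟨hx0, isArcOn_of_lipschitzOnWith fun t ht => ⟨ht.1, hlip' t ht.1⟩, ?_⟩
    rw [ae_restrict_iff' measurableSet_Ico]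
    have hne : ∀ᵐ t : ℝ, t ≠ 0 := by simp [ae_iff, measure_singleton]
    filter_upwards [hae, hne] with t h1 h2 h3
    have h0 : 0 < t := lt_of_le_of_ne h3.1 h2.symm
    exact ⟨_, (h1 h0).hasDerivAt, hincl t h0 (hR t h3) _ (h1 h0).hasDerivAt⟩
  -- At a first time `T` reaching the cut-off, `x` is a genuine solution before `T`, so the a priori
  -- bound and continuity give `‖x T - x₀‖ ≤ c + T`, a contradiction.
  have hR : ∀ t, 0 ≤ t → ‖x t - x₀‖ < c + 1 + t := by
    by_contra! hcon
    obtain ⟨t₁, ht₁, hb⟩ := hcon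
    have hφ : ContinuousOn (fun t => ‖x t - x₀‖ - t) (Set.Icc 0 t₁) :=
      (((hcont.mono Set.Icc_subset_Ici_self).sub continuousOn_const).norm).sub continuousOn_id
    have hcpt : IsCompact (Set.Icc 0 t₁ ∩ (fun t => ‖x t - x₀‖ - t) ⁻¹' Set.Ici (c + 1)) :=
      isCompact_Icc.of_isClosed_subset (hφ.preimage_isClosed_of_isClosed isClosed_Icc isClosed_Ici)
        Set.inter_subset_left
    obtain ⟨T, ⟨hT1, hT2⟩, hleast⟩ := hcpt.exists_isLeast
      ⟨t₁, ⟨ht₁, le_rfl⟩, by simp only [Set.mem_preimage, Set.mem_Ici]; linarith⟩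
    simp only [Set.mem_preimage, Set.mem_Ici] at hT2
    have hT0 : 0 < T := by
      refine lt_of_le_of_ne hT1.1 fun h => ?_
      rw [← h, hx0] at hT2
      simp at hT2
      linarith
    have hbd : ∀ t ∈ Set.Ico 0 T, ‖x t - x₀‖ - t ≤ c := fun t ht => by
      have := hbound T hT0 x (hsol T hT0 fun s hs => by
        by_contra! hcon
        have := hleast ⟨⟨hs.1, hs.2.le.trans hT1.2⟩, by
          simp only [Set.mem_preimage, Set.mem_Ici]; linarith⟩
        exact absurd hs.2 (not_lt.2 this)) t ht
      linarith
    have hcl' : ‖x T - x₀‖ - T ≤ c := by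
      have hTc : ContinuousWithinAt (fun t => ‖x t - x₀‖ - t) (Set.Ico 0 T) T :=
        (hφ T hT1).mono fun s hs => ⟨hs.1, hs.2.le.trans hT1.2⟩
      have hmem : T ∈ closure (Set.Ico 0 T) := by
        rw [closure_Ico hT0.ne]; exact ⟨hT0.le, le_rfl⟩
      have := hTc.mem_closure hmem (t := Set.Iic c) fun t ht => hbd t ht
      simpa using this
    linarith
  refine ⟨x, ⟨hx0, isArcOn_of_lipschitzOnWith fun t ht => ⟨ht, hlip' t ht⟩, ?_⟩, hlip'⟩
  rw [ae_restrict_iff' measurableSet_Ici]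
  have hne : ∀ᵐ t : ℝ, t ≠ 0 := by simp [ae_iff, measure_singleton]
  filter_upwards [hae, hne] with t h1 h2 h3
  have h0 : 0 < t := lt_of_le_of_ne h3 h2.symm
  exact ⟨_, (h1 h0).hasDerivAt, hincl t h0 (hR t h3) _ (h1 h0).hasDerivAt⟩

/-- Concatenation of a solution on `[0, T)` with a solution that starts from its end point. -/
theorem IsSolutionOn.exists_extension {f : E → ℝ} {x₀ : E} {T : ℝ} (hT : 0 < T) {x : ℝ → E}
    (hx : IsSolutionOn f x₀ (Set.Ico 0 T) x) {K : NNReal}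
    (hK : LipschitzOnWith K x (Set.Ico 0 T))
    (hext : ∀ y₀, ∃ y : ℝ → E, IsSolutionOn f y₀ (Set.Ici 0) y ∧
      ∀ t, 0 ≤ t → ∃ K, LipschitzOnWith K y (Set.Icc 0 t)) :
    ∃ y : ℝ → E, IsSolutionOn f x₀ (Set.Ici 0) y ∧ Set.EqOn y x (Set.Ico 0 T) := by
  -- The Lipschitz extension supplies the limit `g T`, from which the second solution starts.
  obtain ⟨g, hg, hgx⟩ := hK.extend_finite_dimension
  obtain ⟨y, hy, hyK⟩ := hext (g T)
  let z : ℝ → E := fun t => if t < T then x t else y (t - T)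
  have hz1 : ∀ t, t < T → z t = x t := fun t ht => if_pos ht
  have hz2 : ∀ t, T ≤ t → z t = y (t - T) := fun t ht => if_neg (not_lt.2 ht)
  refine ⟨z, ⟨by rw [hz1 0 hT, hx.1], isArcOn_of_lipschitzOnWith fun t ht => ⟨ht, ?_⟩, ?_⟩,
    fun t ht => hz1 t ht.2⟩
  · have h1 : Set.EqOn z g (Set.Icc 0 T) := fun s hs => by
      rcases hs.2.lt_or_eq with h | h
      · rw [hz1 s h]; exact hgx ⟨hs.1, h⟩
      · rw [hz2 s h.ge, h, sub_self, hy.1]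
    have h2 : LipschitzOnWith (lipschitzExtensionConstant E * K) z (Set.Icc 0 T) :=
      fun r hr s hs => by
      rw [h1 hr, h1 hs]; exact hg r s
    have ht0 : 0 ≤ max t T - T := sub_nonneg.2 (le_max_right _ _)
    obtain ⟨K', hK'⟩ := hyK (max t T - T) ht0
    have h3 : LipschitzOnWith K' z (Set.Icc T (max t T)) := by
      refine LipschitzOnWith.of_dist_le_mul fun r hr s hs => ?_
      rw [hz2 r hr.1, hz2 s hs.1]
      have := hK'.dist_le_mul (r - T) ⟨by linarith [hr.1], by linarith [hr.2]⟩ (s - T)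
        ⟨by linarith [hs.1], by linarith [hs.2]⟩
      rwa [dist_sub_right] at this
    exact ⟨_, (h2.Icc_glue hT.le h3).mono (Set.Icc_subset_Icc_right (le_max_left _ _))⟩
  · rw [ae_restrict_iff' measurableSet_Ici]
    have hne : ∀ᵐ t : ℝ, t ≠ T := by simp [ae_iff, measure_singleton]
    have hy' := (ae_restrict_iff' measurableSet_Ici).1 hy.2.2
    have hy'' := (measurePreserving_sub_right volume T).quasiMeasurePreserving.ae hy'
    filter_upwards [(ae_restrict_iff' measurableSet_Ico).1 hx.2.2, hy'', hne] with t h1 h2 h3 h4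
    rcases lt_or_gt_of_ne h3 with h | h
    · obtain ⟨w, hw, hw'⟩ := h1 ⟨h4, h⟩
      rw [← hz1 t h] at hw'
      refine ⟨w, hw.congr_of_eventuallyEq ?_, hw'⟩
      filter_upwards [Iio_mem_nhds h] with s hs using hz1 s hs
    · obtain ⟨w, hw, hw'⟩ := h2 (by simpa using h.le)
      rw [← hz2 t h.le] at hw'
      refine ⟨w, ((hw.comp_sub_const t T)).congr_of_eventuallyEq ?_, hw'⟩
      filter_upwards [Ioi_mem_nhds h] with s hs using hz2 s (le_of_lt hs)

end Existence

namespace ReLUNet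

/-! ### Frobenius norm, operator norm and smallest singular value -/

section Matrix

open scoped Matrix

variable {m n k : ℕ}

theorem frobNorm_eq_norm (A : Matrix (Fin m) (Fin n) ℝ) :
    frobNorm A = ‖WithLp.toLp 2 fun p : Fin m × Fin n => A p.1 p.2‖ := by
  rw [frobNorm, EuclideanSpace.norm_eq, Fintype.sum_prod_type]
  simp

theorem frobNorm_nonneg (A : Matrix (Fin m) (Fin n) ℝ) : 0 ≤ frobNorm A := Real.sqrt_nonneg _

theorem frobNorm_sq (A : Matrix (Fin m) (Fin n) ℝ) : frobNorm A ^ 2 = ∑ i, ∑ j, A i j ^ 2 :=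
  Real.sq_sqrt (by positivity)

theorem frobNorm_add_le (A B : Matrix (Fin m) (Fin n) ℝ) :
    frobNorm (A + B) ≤ frobNorm A + frobNorm B := by
  simp only [frobNorm_eq_norm]
  exact norm_add_le (WithLp.toLp 2 fun p : Fin m × Fin n => A p.1 p.2)
    (WithLp.toLp 2 fun p : Fin m × Fin n => B p.1 p.2)

theorem frobNorm_le_of_abs_le {A B : Matrix (Fin m) (Fin n) ℝ} (h : ∀ i j, |A i j| ≤ |B i j|) :
    frobNorm A ≤ frobNorm B :=
  Real.sqrt_le_sqrt (Finset.sum_le_sum fun i _ => Finset.sum_le_sum fun j _ =>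
    sq_le_sq.2 (h i j))

theorem frobNorm_transpose (A : Matrix (Fin m) (Fin n) ℝ) : frobNorm Aᵀ = frobNorm A := by
  rw [frobNorm, frobNorm, Finset.sum_comm]
  rfl

theorem frobNorm_neg (A : Matrix (Fin m) (Fin n) ℝ) : frobNorm (-A) = frobNorm A := by
  simp [frobNorm]

theorem frobNorm_mul_le (A : Matrix (Fin m) (Fin n) ℝ) (B : Matrix (Fin n) (Fin k) ℝ) :
    frobNorm (A * B) ≤ frobNorm A * frobNorm B := by
  refine abs_le_of_sq_le_sq' ?_ (mul_nonneg (frobNorm_nonneg _) (frobNorm_nonneg _)) |>.2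
  rw [mul_pow, frobNorm_sq, frobNorm_sq, frobNorm_sq, Finset.sum_mul]
  refine Finset.sum_le_sum fun i _ => ?_
  rw [Finset.sum_comm (f := fun a b => B a b ^ 2), Finset.mul_sum]
  refine Finset.sum_le_sum fun j _ => ?_
  rw [Matrix.mul_apply]
  exact Finset.sum_mul_sq_le_sq_mul_sq _ _ _

theorem frobNorm_sq_eq_sum_col (A : Matrix (Fin m) (Fin n) ℝ) :
    frobNorm A ^ 2 = ∑ j, ‖WithLp.toLp 2 (A.col j)‖ ^ 2 := by
  rw [frobNorm_sq, Finset.sum_comm]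
  simp [EuclideanSpace.norm_sq_eq, Matrix.col]

theorem toEuclideanLin_col (A : Matrix (Fin m) (Fin n) ℝ) (B : Matrix (Fin n) (Fin k) ℝ)
    (j : Fin k) :
    Matrix.toEuclideanLin A (WithLp.toLp 2 (B.col j)) = WithLp.toLp 2 ((A * B).col j) := by
  ext i
  simp [Matrix.toLpLin_apply, Matrix.mulVec, dotProduct, Matrix.mul_apply, Matrix.col]

theorem opNorm_nonneg (A : Matrix (Fin m) (Fin n) ℝ) : 0 ≤ opNorm A := norm_nonneg _

theorem frobNorm_mul_le_opNorm (A : Matrix (Fin m) (Fin n) ℝ) (B : Matrix (Fin n) (Fin k) ℝ) :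
    frobNorm (A * B) ≤ opNorm A * frobNorm B := by
  refine abs_le_of_sq_le_sq' ?_ (mul_nonneg (opNorm_nonneg _) (frobNorm_nonneg _)) |>.2
  rw [mul_pow, frobNorm_sq_eq_sum_col, frobNorm_sq_eq_sum_col, Finset.mul_sum]
  refine Finset.sum_le_sum fun j _ => ?_
  rw [← mul_pow, ← toEuclideanLin_col]
  exact pow_le_pow_left₀ (norm_nonneg _)
    ((Matrix.toEuclideanLin A).toContinuousLinearMap.le_opNorm _) 2

open scoped Matrix.Norms.L2Operator in
theorem opNorm_transpose (A : Matrix (Fin m) (Fin n) ℝ) : opNorm Aᵀ = opNorm A := by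
  have h := Matrix.l2_opNorm_conjTranspose A
  rw [Matrix.conjTranspose_eq_transpose_of_trivial, Matrix.l2_opNorm_def,
    Matrix.l2_opNorm_def] at h
  exact h

/-- Both sides are expanded in an orthonormal eigenbasis and compared term by term. -/
theorem lambdaMin_mul_norm_sq_le {A : Matrix (Fin n) (Fin n) ℝ} (hA : A.IsHermitian)
    (y : EuclideanSpace ℝ (Fin n)) :
    lambdaMin A hA * ‖y‖ ^ 2 ≤ inner ℝ y (Matrix.toEuclideanLin A y) := by
  have hsym := Matrix.isSymmetric_toEuclideanLin_iff.2 hA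
  have heig : ∀ i, Matrix.toEuclideanLin A (hA.eigenvectorBasis i) =
      hA.eigenvalues i • hA.eigenvectorBasis i := fun i => by
    ext j
    have := congrFun (hA.mulVec_eigenvectorBasis i) j
    simpa [Matrix.toLpLin_apply] using this
  have hi : ∀ i, inner ℝ (hA.eigenvectorBasis i) (Matrix.toEuclideanLin A y) =
      hA.eigenvalues i * inner ℝ (hA.eigenvectorBasis i) y := fun i => by
    rw [← hsym, heig, inner_smul_left]; simp
  rw [← hA.eigenvectorBasis.sum_inner_mul_inner, ← hA.eigenvectorBasis.sum_sq_norm_inner_right y,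
    Finset.mul_sum]
  refine Finset.sum_le_sum fun i _ => ?_
  rw [hi, real_inner_comm, Real.norm_eq_abs, sq_abs]
  have : lambdaMin A hA ≤ hA.eigenvalues i := ciInf_le (Set.finite_range _).bddBelow i
  nlinarith [mul_le_mul_of_nonneg_right this (sq_nonneg (inner ℝ (hA.eigenvectorBasis i) y))]

theorem sigmaMin_mul_norm_le (A : Matrix (Fin m) (Fin n) ℝ) (y : EuclideanSpace ℝ (Fin n)) :
    sigmaMin A * ‖y‖ ≤ ‖Matrix.toEuclideanLin A y‖ := by
  rcases le_or_gt (lambdaMin (Aᵀ * A) (isHermitian_transpose_mul_self A)) 0 with h | h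
  · rw [sigmaMin, Real.sqrt_eq_zero_of_nonpos h, zero_mul]
    exact norm_nonneg _
  refine abs_le_of_sq_le_sq' ?_ (norm_nonneg _) |>.2
  rw [mul_pow, sigmaMin, Real.sq_sqrt h.le]
  refine (lambdaMin_mul_norm_sq_le _ y).trans_eq ?_
  have h1 : Matrix.toEuclideanLin (Aᵀ * A) y =
      Matrix.toEuclideanLin Aᵀ (Matrix.toEuclideanLin A y) := by
    ext i; simp [Matrix.toLpLin_apply, Matrix.mulVec_mulVec]
  rw [h1, ← Matrix.conjTranspose_eq_transpose_of_trivial,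
    Matrix.toEuclideanLin_conjTranspose_eq_adjoint, LinearMap.adjoint_inner_right,
    real_inner_self_eq_norm_sq]

theorem sigmaMin_mul_frobNorm_le (A : Matrix (Fin m) (Fin n) ℝ) (B : Matrix (Fin n) (Fin k) ℝ) :
    sigmaMin A * frobNorm B ≤ frobNorm (A * B) := by
  refine abs_le_of_sq_le_sq' ?_ (frobNorm_nonneg _) |>.2
  rw [mul_pow, frobNorm_sq_eq_sum_col, frobNorm_sq_eq_sum_col, Finset.mul_sum]
  refine Finset.sum_le_sum fun j _ => ?_
  rw [← mul_pow, ← toEuclideanLin_col]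
  exact pow_le_pow_left₀ (mul_nonneg (Real.sqrt_nonneg _) (norm_nonneg _))
    (sigmaMin_mul_norm_le _ _) 2

end Matrix

/-! ### Formal gradients and the subdifferential of the network loss -/

section Network

open scoped Matrix

variable {N d₀ d₁ d₂ : ℕ}

/-- The coordinates of `θ = (W, V)` that belong to `W`. -/
noncomputable def projW : Param d₀ d₁ d₂ →L[ℝ] EuclideanSpace ℝ (Fin d₀ × Fin d₁) :=
  LinearMap.toContinuousLinearMap
    { toFun := fun θ => WithLp.toLp 2 fun p => θ (Sum.inl p)
      map_add' := fun _ _ => rfl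
      map_smul' := fun _ _ => rfl }

/-- The coordinates of `θ = (W, V)` that belong to `V`. -/
noncomputable def projV : Param d₀ d₁ d₂ →L[ℝ] EuclideanSpace ℝ (Fin d₁ × Fin d₂) :=
  LinearMap.toContinuousLinearMap
    { toFun := fun θ => WithLp.toLp 2 fun p => θ (Sum.inr p)
      map_add' := fun _ _ => rfl
      map_smul' := fun _ _ => rfl }

theorem norm_projW (θ : Param d₀ d₁ d₂) : ‖projW θ‖ = frobNorm (weightW θ) :=
  (frobNorm_eq_norm (weightW θ)).symm

theorem norm_projV (θ : Param d₀ d₁ d₂) : ‖projV θ‖ = frobNorm (weightV θ) :=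
  (frobNorm_eq_norm (weightV θ)).symm

theorem norm_sq_eq_add (θ : Param d₀ d₁ d₂) : ‖θ‖ ^ 2 = ‖projW θ‖ ^ 2 + ‖projV θ‖ ^ 2 := by
  rw [EuclideanSpace.norm_sq_eq, EuclideanSpace.norm_sq_eq, EuclideanSpace.norm_sq_eq,
    Fintype.sum_sum_type]
  rfl

theorem inner_eq_sum (θ η : Param d₀ d₁ d₂) :
    inner ℝ θ η = (∑ i, ∑ j, weightW θ i j * weightW η i j) +
      ∑ j, ∑ k, weightV θ j k * weightV η j k := by
  rw [PiLp.inner_apply, Fintype.sum_sum_type, Fintype.sum_prod_type, Fintype.sum_prod_type]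
  simp [weightW, weightV, mul_comm]

theorem weightW_sub (θ η : Param d₀ d₁ d₂) : weightW (θ - η) = weightW θ - weightW η := rfl

/-- The residual `φ(XW)V - Y`. -/
noncomputable def resid (X : Matrix (Fin N) (Fin d₀) ℝ) (Y : Matrix (Fin N) (Fin d₂) ℝ)
    (θ : Param d₀ d₁ d₂) : Matrix (Fin N) (Fin d₂) ℝ := output X θ - Y

/-- The formal gradient of the loss at `θ` when the ReLU of the preactivation `(XW)ₙⱼ` is given
the slope `s n j`. -/
noncomputable def genGrad (X : Matrix (Fin N) (Fin d₀) ℝ) (Y : Matrix (Fin N) (Fin d₂) ℝ)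
    (s : Fin N → Fin d₁ → ℝ) (θ : Param d₀ d₁ d₂) : Param d₀ d₁ d₂ :=
  WithLp.toLp 2 (Sum.elim
    (fun p => (Xᵀ * Matrix.of fun n j => s n j * (resid X Y θ * (weightV θ)ᵀ) n j) p.1 p.2)
    (fun p => ((hidden X θ)ᵀ * resid X Y θ) p.1 p.2))

theorem weightW_genGrad (X : Matrix (Fin N) (Fin d₀) ℝ) (Y : Matrix (Fin N) (Fin d₂) ℝ)
    (s : Fin N → Fin d₁ → ℝ) (θ : Param d₀ d₁ d₂) : weightW (genGrad X Y s θ) =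
      Xᵀ * Matrix.of fun n j => s n j * (resid X Y θ * (weightV θ)ᵀ) n j := rfl

theorem weightV_genGrad (X : Matrix (Fin N) (Fin d₀) ℝ) (Y : Matrix (Fin N) (Fin d₂) ℝ)
    (s : Fin N → Fin d₁ → ℝ) (θ : Param d₀ d₁ d₂) : weightV (genGrad X Y s θ) =
      (hidden X θ)ᵀ * resid X Y θ := rfl

/-- The admissible slopes of the ReLUs at `θ`. -/
def IsPattern (X : Matrix (Fin N) (Fin d₀) ℝ) (θ : Param d₀ d₁ d₂) (s : Fin N → Fin d₁ → ℝ) :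
    Prop :=
  ∀ n j, s n j ∈ Set.Icc (0 : ℝ) 1 ∧ (0 < (X * weightW θ) n j → s n j = 1) ∧
    ((X * weightW θ) n j < 0 → s n j = 0)

theorem loss_eq_frobNorm_resid (X : Matrix (Fin N) (Fin d₀) ℝ) (Y : Matrix (Fin N) (Fin d₂) ℝ)
    (θ : Param d₀ d₁ d₂) : loss X Y θ = 1 / 2 * frobNorm (resid X Y θ) ^ 2 := by
  rw [loss, resid, ← frobNorm_neg (output X θ - Y), neg_sub]

theorem loss_nonneg (X : Matrix (Fin N) (Fin d₀) ℝ) (Y : Matrix (Fin N) (Fin d₂) ℝ)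
    (θ : Param d₀ d₁ d₂) : 0 ≤ loss X Y θ := by
  rw [loss]; positivity

/-- The backpropagation identity: the right side is the directional derivative of the loss given by
the product rule with ReLU slopes `s`. -/
theorem inner_genGrad (X : Matrix (Fin N) (Fin d₀) ℝ) (Y : Matrix (Fin N) (Fin d₂) ℝ)
    (s : Fin N → Fin d₁ → ℝ) (θ w : Param d₀ d₁ d₂) :
    inner ℝ (genGrad X Y s θ) w = ∑ n, ∑ k, resid X Y θ n k *
      ∑ j, (s n j * (X * weightW w) n j * weightV θ j k + hidden X θ n j * weightV w j k) := by
  rw [inner_eq_sum, weightW_genGrad, weightV_genGrad]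
  simp only [Finset.sum_add_distrib, mul_add]
  congr 1
  · simp only [Matrix.mul_apply, Matrix.transpose_apply, Matrix.of_apply, Finset.sum_mul,
      Finset.mul_sum]
    calc _ = ∑ i, ∑ j, ∑ n, ∑ k, resid X Y θ n k *
          (s n j * (X n i * weightW w i j) * weightV θ j k) := by
            refine Finset.sum_congr rfl fun i _ => Finset.sum_congr rfl fun j _ =>
              Finset.sum_congr rfl fun n _ => Finset.sum_congr rfl fun k _ => by ring
      _ = ∑ i, ∑ n, ∑ j, ∑ k, resid X Y θ n k *
          (s n j * (X n i * weightW w i j) * weightV θ j k) :=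
            Finset.sum_congr rfl fun i _ => Finset.sum_comm
      _ = ∑ n, ∑ i, ∑ j, ∑ k, resid X Y θ n k *
          (s n j * (X n i * weightW w i j) * weightV θ j k) := Finset.sum_comm
      _ = ∑ n, ∑ i, ∑ k, ∑ j, resid X Y θ n k *
          (s n j * (X n i * weightW w i j) * weightV θ j k) :=
            Finset.sum_congr rfl fun n _ => Finset.sum_congr rfl fun i _ => Finset.sum_comm
      _ = ∑ n, ∑ k, ∑ i, ∑ j, resid X Y θ n k *
          (s n j * (X n i * weightW w i j) * weightV θ j k) :=
            Finset.sum_congr rfl fun n _ => Finset.sum_comm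
      _ = _ := Finset.sum_congr rfl fun n _ => Finset.sum_congr rfl fun k _ => Finset.sum_comm
  · simp only [Matrix.mul_apply, Matrix.transpose_apply, Finset.sum_mul, Finset.mul_sum]
    calc _ = ∑ j, ∑ k, ∑ n, resid X Y θ n k * (hidden X θ n j * weightV w j k) := by
            refine Finset.sum_congr rfl fun j _ => Finset.sum_congr rfl fun k _ =>
              Finset.sum_congr rfl fun n _ => by ring
      _ = ∑ j, ∑ n, ∑ k, resid X Y θ n k * (hidden X θ n j * weightV w j k) :=
            Finset.sum_congr rfl fun j _ => Finset.sum_comm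
      _ = ∑ n, ∑ j, ∑ k, resid X Y θ n k * (hidden X θ n j * weightV w j k) := Finset.sum_comm
      _ = _ := Finset.sum_congr rfl fun n _ => Finset.sum_comm

theorem loss_eq_sum (X : Matrix (Fin N) (Fin d₀) ℝ) (Y : Matrix (Fin N) (Fin d₂) ℝ)
    (θ : Param d₀ d₁ d₂) :
    loss X Y θ = 1 / 2 * ∑ n, ∑ k, ((∑ j, hidden X θ n j * weightV θ j k) - Y n k) ^ 2 := by
  rw [loss_eq_frobNorm_resid, frobNorm_sq]
  rfl

theorem hasDerivWithinAt_weightV {c : ℝ → Param d₀ d₁ d₂} {w : Param d₀ d₁ d₂} {S : Set ℝ}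
    {t : ℝ} (hc : HasDerivWithinAt c w S t) (j : Fin d₁) (k : Fin d₂) :
    HasDerivWithinAt (fun r => weightV (c r) j k) (weightV w j k) S t :=
  (EuclideanSpace.proj (Sum.inr (j, k)) : Param d₀ d₁ d₂ →L[ℝ] ℝ).hasFDerivAt.comp_hasDerivWithinAt t hc

theorem hasDerivWithinAt_preactivation (X : Matrix (Fin N) (Fin d₀) ℝ)
    {c : ℝ → Param d₀ d₁ d₂} {w : Param d₀ d₁ d₂} {S : Set ℝ}
    {t : ℝ} (hc : HasDerivWithinAt c w S t) (n : Fin N) (j : Fin d₁) :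
    HasDerivWithinAt (fun r => (X * weightW (c r)) n j) ((X * weightW w) n j) S t := by
  simp only [Matrix.mul_apply]
  exact HasDerivWithinAt.fun_sum fun i _ =>
    ((EuclideanSpace.proj (Sum.inl (i, j)) : Param d₀ d₁ d₂ →L[ℝ] ℝ).hasFDerivAt.comp_hasDerivWithinAt t hc).const_mul (X n i)

/-- Chain rule for the loss along a curve on which the hidden layer is differentiable. -/
theorem hasDerivWithinAt_loss (X : Matrix (Fin N) (Fin d₀) ℝ) (Y : Matrix (Fin N) (Fin d₂) ℝ)
    {c : ℝ → Param d₀ d₁ d₂} {w : Param d₀ d₁ d₂} {S : Set ℝ} {t : ℝ} {s : Fin N → Fin d₁ → ℝ}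
    (hc : HasDerivWithinAt c w S t)
    (hH : ∀ n j, HasDerivWithinAt (fun r => hidden X (c r) n j)
      (s n j * (X * weightW w) n j) S t) :
    HasDerivWithinAt (fun r => loss X Y (c r)) (inner ℝ (genGrad X Y s (c t)) w) S t := by
  simp only [loss_eq_sum]
  have h1 : ∀ n k, HasDerivWithinAt
      (fun r => ((∑ j, hidden X (c r) n j * weightV (c r) j k) - Y n k) ^ 2)
      (2 * (resid X Y (c t) n k * ∑ j, (s n j * (X * weightW w) n j * weightV (c t) j k +
        hidden X (c t) n j * weightV w j k))) S t := fun n k => by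
    have h2 : HasDerivWithinAt (fun r => (∑ j, hidden X (c r) n j * weightV (c r) j k) - Y n k)
        (∑ j, (s n j * (X * weightW w) n j * weightV (c t) j k +
        hidden X (c t) n j * weightV w j k)) S t :=
      (HasDerivWithinAt.fun_sum fun j _ =>
        (hH n j).mul (hasDerivWithinAt_weightV hc j k)).sub_const _
    convert! h2.pow 2 using 1
    have : resid X Y (c t) n k = (∑ j, hidden X (c t) n j * weightV (c t) j k) - Y n k := rfl
    rw [this]
    push_cast
    ring
  have h3 := (HasDerivWithinAt.fun_sum (u := Finset.univ) fun n _ =>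
    HasDerivWithinAt.fun_sum (u := Finset.univ) fun k _ => h1 n k).const_mul (1 / 2 : ℝ)
  rw [inner_genGrad]
  convert! h3 using 1
  simp only [← Finset.mul_sum]
  ring

/-- At a zero of `f` with `d = 0`, the ReLU being 1-Lipschitz preserves the `o(r - t)` increment, so
every slope `s` is correct. -/
theorem hasDerivWithinAt_relu {f : ℝ → ℝ} {d s t : ℝ} {S : Set ℝ} (hf : HasDerivWithinAt f d S t)
    (hpos : 0 < f t → s = 1) (hneg : f t < 0 → s = 0) (hzero : f t = 0 → d = 0) :
    HasDerivWithinAt (fun r => relu (f r)) (s * d) S t := by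
  rcases lt_trichotomy (f t) 0 with h | h | h
  · rw [hneg h, zero_mul]
    refine (hasDerivWithinAt_const t S 0).congr_of_eventuallyEq ?_ (max_eq_right h.le)
    filter_upwards [hf.continuousWithinAt.eventually (gt_mem_nhds h)] with r hr
      using max_eq_right hr.le
  · have hd := hzero h
    rw [hd, mul_zero]
    rw [hd, hasDerivWithinAt_iff_isLittleO] at hf
    rw [hasDerivWithinAt_iff_isLittleO]
    refine Asymptotics.IsBigO.trans_isLittleO (Asymptotics.isBigO_of_le _ fun r => ?_) hf
    simp only [h, relu, smul_zero, sub_zero, max_self, Real.norm_eq_abs]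
    simpa using abs_max_sub_max_le_abs (f r) 0 0
  · rw [hpos h, one_mul]
    refine hf.congr_of_eventuallyEq ?_ (max_eq_left h.le)
    filter_upwards [hf.continuousWithinAt.eventually (lt_mem_nhds h)] with r hr
      using max_eq_left hr.le

/-- One-sided derivative of the ReLU along a line. -/
theorem hasDerivWithinAt_relu_line (z d : ℝ) :
    HasDerivWithinAt (fun r : ℝ => relu (z + r * d))
      ((if 0 < z then 1 else if z < 0 then 0 else if 0 < d then 1 else 0) * d) (Set.Ici 0) 0 := by
  have hl : HasDerivWithinAt (fun r : ℝ => z + r * d) d (Set.Ici 0) 0 := by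
    simpa using (((hasDerivAt_id (0 : ℝ)).mul_const d).const_add z).hasDerivWithinAt
  rcases lt_trichotomy z 0 with h | h | h
  · refine hasDerivWithinAt_relu hl ?_ ?_ ?_ <;> simp [h, h.ne, not_lt.2 h.le]
  · subst h
    simp only [lt_irrefl, if_false, zero_add] at hl ⊢
    by_cases hd : 0 < d
    · rw [if_pos hd, one_mul]
      exact hl.congr (fun r hr => max_eq_left (mul_nonneg hr hd.le)) (by simp [relu])
    · rw [if_neg hd, zero_mul]
      exact (hasDerivWithinAt_const _ _ 0).congr
        (fun r hr => max_eq_right (mul_nonpos_of_nonneg_of_nonpos hr (not_lt.1 hd)))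
        (by simp [relu])
  · refine hasDerivWithinAt_relu hl ?_ ?_ ?_ <;> simp [h, h.ne', not_lt.2 h.le]

/-- The slope pattern that is `1/2` at the kinks. -/
noncomputable def midPattern (X : Matrix (Fin N) (Fin d₀) ℝ) (θ : Param d₀ d₁ d₂)
    (n : Fin N) (j : Fin d₁) : ℝ :=
  if 0 < (X * weightW θ) n j then 1 else if (X * weightW θ) n j < 0 then 0 else 1 / 2

/-- The slope pattern seen when leaving `θ` in the direction `w`. -/
noncomputable def dirPattern (X : Matrix (Fin N) (Fin d₀) ℝ) (θ w : Param d₀ d₁ d₂)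
    (n : Fin N) (j : Fin d₁) : ℝ :=
  if 0 < (X * weightW θ) n j then 1 else if (X * weightW θ) n j < 0 then 0 else
    if 0 < (X * weightW w) n j then 1 else 0

theorem inner_gradient_loss (X : Matrix (Fin N) (Fin d₀) ℝ) (Y : Matrix (Fin N) (Fin d₂) ℝ)
    {θ : Param d₀ d₁ d₂} (h : DifferentiableAt ℝ (loss X Y) θ) (w : Param d₀ d₁ d₂) :
    inner ℝ (gradient (loss X Y) θ) w = inner ℝ (genGrad X Y (dirPattern X θ w) θ) w := by
  have hc : HasDerivAt (fun r : ℝ => θ + r • w) w 0 := by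
    simpa using ((hasDerivAt_id (0 : ℝ)).smul_const w).const_add θ
  have h1 : HasDerivWithinAt (fun r : ℝ => loss X Y (θ + r • w))
      (inner ℝ (gradient (loss X Y) θ) w) (Set.Ici 0) 0 := by
    have hg := h.hasGradientAt.hasFDerivAt
    have e : θ = θ + (0 : ℝ) • w := by simp
    rw [e] at hg
    have := hg.comp_hasDerivAt (0 : ℝ) hc
    simp only [zero_smul, add_zero] at this
    exact this.hasDerivWithinAt
  have h2 := hasDerivWithinAt_loss X Y (s := dirPattern X θ w) (hc.hasDerivWithinAt (s := Set.Ici 0))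
    fun n j => by
      have := hasDerivWithinAt_relu_line ((X * weightW θ) n j) ((X * weightW w) n j)
      refine this.congr_of_mem (fun r _ => ?_) Set.self_mem_Ici
      change relu ((X * weightW (θ + r • w)) n j) = _
      have e : X * weightW (θ + r • w) = X * weightW θ + r • (X * weightW w) := by
        rw [← Matrix.mul_smul, ← Matrix.mul_add]; rfl
      rw [e]; rfl
  simp only [zero_smul, add_zero] at h2
  exact (uniqueDiffWithinAt_Ici (0 : ℝ)).eq_deriv _ h1 h2

/-- The loss may be differentiable at a point where some preactivation vanishes. The one-sided
derivatives along `w` and `-w` then both compute the gradient, and averaging them turns the kink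
slopes 0 and 1 into `1/2`. -/
theorem gradient_loss_eq (X : Matrix (Fin N) (Fin d₀) ℝ) (Y : Matrix (Fin N) (Fin d₂) ℝ)
    {θ : Param d₀ d₁ d₂} (h : DifferentiableAt ℝ (loss X Y) θ) :
    gradient (loss X Y) θ = genGrad X Y (midPattern X θ) θ := by
  refine ext_inner_right ℝ fun w => ?_
  have h1 := inner_gradient_loss X Y h w
  have h2 := inner_gradient_loss X Y h (-w)
  have hneg : X * weightW (-w) = -(X * weightW w) := by
    rw [← Matrix.mul_neg]; rfl
  rw [inner_neg_right, inner_neg_right, neg_inj] at h2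
  have h3 : inner ℝ (gradient (loss X Y) θ) w =
      1 / 2 * (inner ℝ (genGrad X Y (dirPattern X θ w) θ) w +
        inner ℝ (genGrad X Y (dirPattern X θ (-w)) θ) w) := by
    linarith
  rw [h3, inner_genGrad, inner_genGrad, inner_genGrad]
  simp only [← Finset.sum_add_distrib, ← mul_add, Finset.mul_sum]
  refine Finset.sum_congr rfl fun n _ => Finset.sum_congr rfl fun k _ =>
    Finset.sum_congr rfl fun j _ => ?_
  have key : 1 / 2 * (dirPattern X θ w n j * (X * weightW w) n j +
      dirPattern X θ (-w) n j * (X * weightW w) n j) =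
      midPattern X θ n j * (X * weightW w) n j := by
    simp only [dirPattern, midPattern, hneg, Matrix.neg_apply, Left.neg_pos_iff]
    rcases lt_trichotomy ((X * weightW θ) n j) 0 with h | h | h
    · simp [h, not_lt.2 h.le]
    · rcases lt_trichotomy ((X * weightW w) n j) 0 with h' | h' | h'
      · simp [h, h', not_lt.2 h'.le]
      · simp [h, h']
      · simp [h, h', not_lt.2 h'.le]
    · simp [h]; ring
  linear_combination resid X Y θ n k * weightV θ j k * key

theorem isPattern_midPattern (X : Matrix (Fin N) (Fin d₀) ℝ) (θ : Param d₀ d₁ d₂) :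
    IsPattern X θ (midPattern X θ) := fun n j => by
  unfold midPattern
  refine ⟨?_, fun h => if_pos h, fun h => by rw [if_neg h.not_gt, if_pos h]⟩
  split_ifs <;> norm_num

theorem continuous_weightW_apply (i : Fin d₀) (j : Fin d₁) :
    Continuous fun θ : Param d₀ d₁ d₂ => weightW θ i j :=
  (EuclideanSpace.proj (𝕜 := ℝ) (Sum.inl (i, j))).continuous

theorem continuous_weightV_apply (j : Fin d₁) (k : Fin d₂) :
    Continuous fun θ : Param d₀ d₁ d₂ => weightV θ j k :=
  (EuclideanSpace.proj (𝕜 := ℝ) (Sum.inr (j, k))).continuous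

theorem continuous_weightW : Continuous (weightW : Param d₀ d₁ d₂ → _) :=
  continuous_matrix continuous_weightW_apply

theorem continuous_weightV : Continuous (weightV : Param d₀ d₁ d₂ → _) :=
  continuous_matrix continuous_weightV_apply

theorem continuous_preactivation (X : Matrix (Fin N) (Fin d₀) ℝ) (n : Fin N) (j : Fin d₁) :
    Continuous fun θ : Param d₀ d₁ d₂ => (X * weightW θ) n j :=
  (continuous_const.matrix_mul continuous_weightW).matrix_elem n j

theorem continuous_hidden (X : Matrix (Fin N) (Fin d₀) ℝ) :
    Continuous (hidden X : Param d₀ d₁ d₂ → _) :=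
  continuous_matrix fun n j => (continuous_preactivation X n j).max continuous_const

theorem continuous_resid (X : Matrix (Fin N) (Fin d₀) ℝ) (Y : Matrix (Fin N) (Fin d₂) ℝ) :
    Continuous (resid X Y : Param d₀ d₁ d₂ → _) :=
  ((continuous_hidden X).matrix_mul continuous_weightV).sub continuous_const

theorem continuous_genGrad (X : Matrix (Fin N) (Fin d₀) ℝ) (Y : Matrix (Fin N) (Fin d₂) ℝ)
    (s : Fin N → Fin d₁ → ℝ) : Continuous (genGrad X Y s : Param d₀ d₁ d₂ → _) := by
  refine (PiLp.continuous_toLp 2 _).comp (continuous_pi fun p => ?_)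
  rcases p with p | p
  · refine (continuous_const.matrix_mul (continuous_matrix fun n j => ?_)).matrix_elem p.1 p.2
    exact (((continuous_resid X Y).matrix_mul
      continuous_weightV.matrix_transpose).matrix_elem n j).const_mul _
  · exact (((continuous_hidden X).matrix_transpose).matrix_mul
      (continuous_resid X Y)).matrix_elem p.1 p.2

/-- The slope patterns with values in `{0, 1/2, 1}`. -/
def gridPatterns (N d₁ : ℕ) : Set (Fin N → Fin d₁ → ℝ) :=
  {s | ∀ n, s n ∈ {r : Fin d₁ → ℝ | ∀ j, r j ∈ ({0, 1 / 2, 1} : Set ℝ)}}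

theorem finite_gridPatterns (N d₁ : ℕ) : (gridPatterns N d₁).Finite :=
  Set.Finite.pi' fun _ => Set.Finite.pi' fun _ => by simp

/-- Only finitely many slope patterns occur, so one of them recurs infinitely often; for a fixed
pattern the formal gradient is continuous in `θ`. Finiteness also makes the convex hull closed in
`isClosed_clarkeSubdifferential_loss`. -/
theorem limiting_gradient_eq (X : Matrix (Fin N) (Fin d₀) ℝ) (Y : Matrix (Fin N) (Fin d₂) ℝ)
    {θ g : Param d₀ d₁ d₂} {u : ℕ → Param d₀ d₁ d₂}
    (hd : ∀ n, DifferentiableAt ℝ (loss X Y) (u n)) (hu : Tendsto u atTop (𝓝 θ))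
    (hg : Tendsto (fun n => gradient (loss X Y) (u n)) atTop (𝓝 g)) :
    ∃ s ∈ gridPatterns N d₁, IsPattern X θ s ∧ g = genGrad X Y s θ := by
  have hmem : ∀ i, midPattern X (u i) ∈ gridPatterns N d₁ := fun i n j => by
    simp only [midPattern]
    split_ifs <;> simp
  obtain ⟨s, hs, hfreq⟩ : ∃ s ∈ gridPatterns N d₁, ∃ᶠ i in atTop, midPattern X (u i) = s := by
    by_contra! hcon
    have h1 : ∀ᶠ i in atTop, ∀ s ∈ gridPatterns N d₁, midPattern X (u i) ≠ s :=
      (finite_gridPatterns N d₁).eventually_all.2 hcon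
    obtain ⟨i, hi⟩ := h1.exists
    exact hi _ (hmem i) rfl
  refine ⟨s, hs, fun n j => ?_, ?_⟩
  · obtain ⟨i, hi⟩ := hfreq.exists
    refine ⟨by rw [← hi]; exact (isPattern_midPattern X (u i) n j).1, fun h => ?_, fun h => ?_⟩
    · obtain ⟨i, hi, hi'⟩ := (hfreq.and_eventually
        (((continuous_preactivation X n j).tendsto θ).comp hu |>.eventually (lt_mem_nhds h))).exists
      rw [← hi]; exact (isPattern_midPattern X (u i) n j).2.1 hi'
    · obtain ⟨i, hi, hi'⟩ := (hfreq.and_eventually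
        (((continuous_preactivation X n j).tendsto θ).comp hu |>.eventually (gt_mem_nhds h))).exists
      rw [← hi]; exact (isPattern_midPattern X (u i) n j).2.2 hi'
  · have h1 := hg.sub (((continuous_genGrad X Y s).tendsto θ).comp hu)
    have h2 := (isClosed_singleton (x := (0 : Param d₀ d₁ d₂))).mem_of_frequently_of_tendsto
      (hfreq.mono fun i hi => by
        change gradient (loss X Y) (u i) - genGrad X Y s (u i) = 0
        rw [gradient_loss_eq X Y (hd i), hi, sub_self]) h1
    exact sub_eq_zero.1 h2

theorem isClosed_clarkeSubdifferential_loss (X : Matrix (Fin N) (Fin d₀) ℝ)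
    (Y : Matrix (Fin N) (Fin d₂) ℝ) (θ : Param d₀ d₁ d₂) :
    IsClosed (clarkeSubdifferential (loss X Y) θ) := by
  refine Set.Finite.isClosed_convexHull ℝ
    (((finite_gridPatterns N d₁).image fun s => genGrad X Y s θ).subset ?_)
  rintro g ⟨u, hd, hu, hg⟩
  obtain ⟨s, hs, -, rfl⟩ := limiting_gradient_eq X Y hd hu hg
  exact ⟨s, hs, rfl⟩

theorem genGrad_combo (X : Matrix (Fin N) (Fin d₀) ℝ) (Y : Matrix (Fin N) (Fin d₂) ℝ)
    (s s' : Fin N → Fin d₁ → ℝ) (θ : Param d₀ d₁ d₂) {a b : ℝ} (hab : a + b = 1) :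
    genGrad X Y (a • s + b • s') θ = a • genGrad X Y s θ + b • genGrad X Y s' θ := by
  ext p
  rcases p with p | p
  · simp only [genGrad, PiLp.add_apply, PiLp.smul_apply, Sum.elim_inl, Matrix.mul_apply (M := Xᵀ),
      Finset.mul_sum, ← Finset.sum_add_distrib,
      Matrix.of_apply, Pi.add_apply, Pi.smul_apply, smul_eq_mul]
    exact Finset.sum_congr rfl fun n _ => by ring
  · change (_ : ℝ) = a * ((hidden X θ)ᵀ * resid X Y θ) p.1 p.2 +
      b * ((hidden X θ)ᵀ * resid X Y θ) p.1 p.2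
    rw [← add_mul, hab, one_mul]
    rfl

/-- The formal gradient is affine in the slopes and the admissible slopes form a convex set, so the
right side is convex. -/
theorem clarkeSubdifferential_loss_subset (X : Matrix (Fin N) (Fin d₀) ℝ)
    (Y : Matrix (Fin N) (Fin d₂) ℝ) (θ : Param d₀ d₁ d₂) :
    clarkeSubdifferential (loss X Y) θ ⊆ {g | ∃ s, IsPattern X θ s ∧ g = genGrad X Y s θ} := by
  refine convexHull_min ?_ ?_
  · rintro g ⟨u, hd, hu, hg⟩
    obtain ⟨s, -, hs, rfl⟩ := limiting_gradient_eq X Y hd hu hg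
    exact ⟨s, hs, rfl⟩
  · rintro _ ⟨s, hs, rfl⟩ _ ⟨s', hs', rfl⟩ a b ha hb hab
    refine ⟨a • s + b • s', fun n j => ⟨?_, fun h => ?_, fun h => ?_⟩,
      (genGrad_combo X Y s s' θ hab).symm⟩
    · exact convex_Icc (0 : ℝ) 1 (hs n j).1 (hs' n j).1 ha hb hab
    · simp [(hs n j).2.1 h, (hs' n j).2.1 h, hab]
    · simp [(hs n j).2.2 h, (hs' n j).2.2 h]

theorem locallyLipschitz_loss (X : Matrix (Fin N) (Fin d₀) ℝ) (Y : Matrix (Fin N) (Fin d₂) ℝ) :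
    LocallyLipschitz (loss X Y : Param d₀ d₁ d₂ → ℝ) := by
  let P : (Fin N → Fin d₁ → ℝ) × Param d₀ d₁ d₂ → ℝ := fun q =>
    1 / 2 * ∑ n, ∑ k, ((∑ j, q.1 n j * q.2 (Sum.inr (j, k))) - Y n k) ^ 2
  have hP : ContDiff ℝ 1 P := by
    unfold P
    fun_prop
  let Z : Param d₀ d₁ d₂ → Fin N → Fin d₁ → ℝ := fun θ n j => (X * weightW θ) n j
  have hZ : ContDiff ℝ 1 Z := by
    unfold Z
    simp only [Matrix.mul_apply, weightW, Matrix.of_apply]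
    fun_prop
  have hR : LipschitzWith 1 fun (z : Fin N → Fin d₁ → ℝ) n j => relu (z n j) := by
    refine LipschitzWith.of_dist_le_mul fun z z' => ?_
    rw [NNReal.coe_one, one_mul]
    refine (dist_pi_le_iff dist_nonneg).2 fun n => (dist_pi_le_iff dist_nonneg).2 fun j => ?_
    refine le_trans ?_ ((dist_le_pi_dist (z n) (z' n) j).trans (dist_le_pi_dist z z' n))
    simpa [relu, Real.dist_eq] using abs_max_sub_max_le_abs (z n j) (z' n j) 0
  have h := hP.locallyLipschitz.comp
    ((hR.locallyLipschitz.comp hZ.locallyLipschitz).prodMk LocallyLipschitz.id)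
  have e : (loss X Y : Param d₀ d₁ d₂ → ℝ) =
      P ∘ fun θ => (((fun (z : Fin N → Fin d₁ → ℝ) n j => relu (z n j)) ∘ Z) θ, id θ) := by
    funext θ
    exact loss_eq_sum X Y θ
  rw [e]
  exact h

theorem frobNorm_hidden_sub_le (X : Matrix (Fin N) (Fin d₀) ℝ) (θ η : Param d₀ d₁ d₂) :
    frobNorm (hidden X θ - hidden X η) ≤ opNorm X * ‖projW (θ - η)‖ := by
  rw [norm_projW, weightW_sub]
  refine le_trans (frobNorm_le_of_abs_le fun n j => ?_) (frobNorm_mul_le_opNorm X _)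
  rw [Matrix.mul_sub]
  exact abs_max_sub_max_le_abs _ _ _

theorem frobNorm_hidden_le (X : Matrix (Fin N) (Fin d₀) ℝ) (θ : Param d₀ d₁ d₂) :
    frobNorm (hidden X θ) ≤ opNorm X * ‖projW θ‖ := by
  rw [norm_projW]
  refine le_trans (frobNorm_le_of_abs_le fun n j => ?_) (frobNorm_mul_le_opNorm X _)
  simpa [hidden, relu] using abs_max_sub_max_le_abs ((X * weightW θ) n j) 0 0

/-- Slopes in `[0,1]` do not increase entries. With `norm_projV_genGrad_le` this gives the
cross-coupling of `W` and `V` behind the hyperbolic comparison. -/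
theorem norm_projW_genGrad_le (X : Matrix (Fin N) (Fin d₀) ℝ) (Y : Matrix (Fin N) (Fin d₂) ℝ)
    {s : Fin N → Fin d₁ → ℝ} {θ : Param d₀ d₁ d₂} (hs : IsPattern X θ s) :
    ‖projW (genGrad X Y s θ)‖ ≤ opNorm X * frobNorm (resid X Y θ) * ‖projV θ‖ := by
  rw [norm_projW, norm_projV, weightW_genGrad, mul_assoc]
  refine (frobNorm_mul_le_opNorm _ _).trans ?_
  rw [opNorm_transpose]
  refine mul_le_mul_of_nonneg_left ?_ (opNorm_nonneg X)
  rw [← frobNorm_transpose (weightV θ)]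
  refine le_trans (frobNorm_le_of_abs_le fun n j => ?_) (frobNorm_mul_le _ _)
  rw [Matrix.of_apply, abs_mul, abs_of_nonneg (hs n j).1.1]
  exact mul_le_of_le_one_left (abs_nonneg _) (hs n j).1.2

theorem norm_projV_genGrad_le (X : Matrix (Fin N) (Fin d₀) ℝ) (Y : Matrix (Fin N) (Fin d₂) ℝ)
    (s : Fin N → Fin d₁ → ℝ) (θ : Param d₀ d₁ d₂) :
    ‖projV (genGrad X Y s θ)‖ ≤ opNorm X * frobNorm (resid X Y θ) * ‖projW θ‖ := by
  rw [norm_projV, weightV_genGrad]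
  refine (frobNorm_mul_le _ _).trans ?_
  rw [frobNorm_transpose]
  nlinarith [mul_le_mul_of_nonneg_right (frobNorm_hidden_le X θ) (frobNorm_nonneg (resid X Y θ))]

theorem norm_genGrad_le (X : Matrix (Fin N) (Fin d₀) ℝ) (Y : Matrix (Fin N) (Fin d₂) ℝ)
    {s : Fin N → Fin d₁ → ℝ} {θ : Param d₀ d₁ d₂} (hs : IsPattern X θ s) :
    ‖genGrad X Y s θ‖ ≤ opNorm X * frobNorm (resid X Y θ) * ‖θ‖ := by
  have h0 : 0 ≤ opNorm X * frobNorm (resid X Y θ) :=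
    mul_nonneg (opNorm_nonneg X) (frobNorm_nonneg _)
  refine abs_le_of_sq_le_sq' ?_ (mul_nonneg h0 (norm_nonneg _)) |>.2
  rw [mul_pow, norm_sq_eq_add, norm_sq_eq_add θ]
  have h1 := pow_le_pow_left₀ (norm_nonneg _) (norm_projW_genGrad_le X Y hs) 2
  have h2 := pow_le_pow_left₀ (norm_nonneg _) (norm_projV_genGrad_le X Y s θ) 2
  rw [mul_pow] at h1 h2
  linarith

/-- Gradient domination by the output layer, at a point whose hidden layer is close to that of
`θ₀`. -/
theorem mul_frobNorm_resid_le (X : Matrix (Fin N) (Fin d₀) ℝ) (Y : Matrix (Fin N) (Fin d₂) ℝ)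
    (s : Fin N → Fin d₁ → ℝ) (θ₀ θ : Param d₀ d₁ d₂) :
    (alpha X θ₀ - opNorm X * ‖projW (θ - θ₀)‖) * frobNorm (resid X Y θ) ≤
      ‖genGrad X Y s θ‖ := by
  have h1 := sigmaMin_mul_frobNorm_le (hidden X θ₀)ᵀ (resid X Y θ)
  have h2 : (hidden X θ₀)ᵀ * resid X Y θ =
      (hidden X θ)ᵀ * resid X Y θ + -((hidden X θ - hidden X θ₀)ᵀ * resid X Y θ) := by
    rw [← Matrix.neg_mul, ← Matrix.add_mul, Matrix.transpose_sub]
    congr 1; abel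
  have h3 := frobNorm_add_le ((hidden X θ)ᵀ * resid X Y θ)
    (-((hidden X θ - hidden X θ₀)ᵀ * resid X Y θ))
  rw [← h2, frobNorm_neg] at h3
  have h4 := (frobNorm_mul_le (hidden X θ - hidden X θ₀)ᵀ (resid X Y θ)).trans
    (mul_le_mul_of_nonneg_right ((frobNorm_transpose _).le.trans (frobNorm_hidden_sub_le X θ θ₀))
      (frobNorm_nonneg _))
  have h5 : frobNorm ((hidden X θ)ᵀ * resid X Y θ) ≤ ‖genGrad X Y s θ‖ := by
    rw [← weightV_genGrad X Y s, ← norm_projV]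
    refine abs_le_of_sq_le_sq' ?_ (norm_nonneg _) |>.2
    rw [norm_sq_eq_add (genGrad X Y s θ)]
    linarith [sq_nonneg ‖projW (genGrad X Y s θ)‖]
  rw [sub_mul]
  change alpha X θ₀ * _ ≤ _ at h1
  linarith

end Network

end ReLUNet

/-! ### Dissipation, a priori bounds and the bootstrap -/

theorem LocallyLipschitz.exists_lipschitzOnWith_comp {α β : Type*} [PseudoMetricSpace α]
    [PseudoMetricSpace β] {f : α → β} (hf : LocallyLipschitz f) {c : ℝ → α} {K : NNReal} {a b : ℝ}
    (hc : LipschitzOnWith K c (Set.Icc a b)) :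
    ∃ K', LipschitzOnWith K' (fun t => f (c t)) (Set.Icc a b) := by
  obtain ⟨K', hK'⟩ := hf.locallyLipschitzOn.exists_lipschitzOnWith_of_compact
    (isCompact_Icc.image_of_continuousOn hc.continuousOn)
  exact ⟨K' * K, hK'.comp hc (Set.mapsTo_image _ _)⟩

theorem LipschitzOnWith.norm_clm_sub_le_integral {E F : Type*} [NormedAddCommGroup E]
    [NormedSpace ℝ E] [NormedAddCommGroup F] [NormedSpace ℝ F] [FiniteDimensional ℝ F]
    {c : ℝ → E} {K : NNReal} {a b : ℝ} (hab : a ≤ b) (hc : LipschitzOnWith K c (Set.Icc a b))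
    (Λ : E →L[ℝ] F) {φ : ℝ → ℝ} (hφ : IntervalIntegrable φ volume a b)
    (h : ∀ᵐ r, r ∈ Set.Ioo a b → ∃ w, HasDerivAt c w r ∧ ‖Λ w‖ ≤ φ r) :
    ‖Λ (c b - c a)‖ ≤ ∫ r in a..b, φ r := by
  have h1 : LipschitzOnWith (‖Λ‖₊ * K) (fun r => Λ (c r)) (Set.Icc a b) :=
    Λ.lipschitz.comp_lipschitzOnWith hc
  rw [map_sub, ← h1.intervalIntegral_deriv_eq_sub hab]
  refine intervalIntegral.norm_integral_le_of_norm_le hab ?_ hφ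
  have hb : ∀ᵐ r : ℝ, r ≠ b := by simp [ae_iff, measure_singleton]
  filter_upwards [h, hb] with r hr hrb hr'
  obtain ⟨w, hw, hw'⟩ := hr ⟨hr'.1, lt_of_le_of_ne hr'.2 hrb⟩
  have hd : HasDerivAt (fun r => Λ (c r)) (Λ w) r := Λ.hasFDerivAt.comp_hasDerivAt r hw
  rw [hd.deriv]
  exact hw'

namespace ReLUNet

variable {N d₀ d₁ d₂ : ℕ} {X : Matrix (Fin N) (Fin d₀) ℝ} {Y : Matrix (Fin N) (Fin d₂) ℝ}
  {θ₀ : Param d₀ d₁ d₂} {θ : ℝ → Param d₀ d₁ d₂} {T t : ℝ}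

/-- Along a curve the chain rule holds almost everywhere, for every admissible slope pattern. -/
theorem ae_hasDerivAt_loss (X : Matrix (Fin N) (Fin d₀) ℝ) (Y : Matrix (Fin N) (Fin d₂) ℝ)
    (c : ℝ → Param d₀ d₁ d₂) :
    ∀ᵐ t, ∀ w, HasDerivAt c w t → ∀ s, IsPattern X (c t) s →
      HasDerivAt (fun r => loss X Y (c r)) (inner ℝ (genGrad X Y s (c t)) w) t := by
  have h : ∀ᵐ t, ∀ n j, ∀ d, HasDerivAt (fun r => (X * weightW (c r)) n j) d t →
      (X * weightW (c t)) n j = 0 → d = 0 :=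
    ae_all_iff.2 fun n => ae_all_iff.2 fun j => ae_hasDerivAt_eq_zero_of_eq_zero _
  filter_upwards [h] with t ht w hw s hs
  rw [← hasDerivWithinAt_univ] at hw ⊢
  refine hasDerivWithinAt_loss X Y hw fun n j => ?_
  have hd := hasDerivWithinAt_preactivation X hw n j
  exact hasDerivWithinAt_relu hd (hs n j).2.1 (hs n j).2.2
    (ht n j _ (hasDerivWithinAt_univ.1 hd))

/-- The pattern `s` that represents the velocity can be reused in the chain rule, which holds for
all admissible patterns; pairing the gradient with minus itself gives the dissipation identity. -/
theorem ae_hasDerivAt_of_isSolutionOn (h : IsSolutionOn (loss X Y) θ₀ (Set.Ico 0 T) θ)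
    (ht : t ≤ T) :
    ∀ᵐ r, r ∈ Set.Ioo 0 t → ∃ s, IsPattern X (θ r) s ∧
      HasDerivAt θ (-genGrad X Y s (θ r)) r ∧
      HasDerivAt (fun r => loss X Y (θ r)) (-‖genGrad X Y s (θ r)‖ ^ 2) r := by
  filter_upwards [h.ae_Ioo ht, ae_hasDerivAt_loss X Y θ] with r h1 h2 hr
  obtain ⟨w, hw, hw'⟩ := h1 hr
  obtain ⟨s, hs, he⟩ := clarkeSubdifferential_loss_subset X Y _ hw'
  have hw2 : w = -genGrad X Y s (θ r) := by rw [← he, neg_neg]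
  rw [hw2] at hw
  refine ⟨s, hs, hw, ?_⟩
  have h3 := h2 _ hw s hs
  rwa [inner_neg_right, real_inner_self_eq_norm_sq] at h3

theorem exists_lipschitzOnWith_comp_loss (X : Matrix (Fin N) (Fin d₀) ℝ)
    (Y : Matrix (Fin N) (Fin d₂) ℝ) {Q : (Param d₀ d₁ d₂ × ℝ) × ℝ → ℝ} (hQ : ContDiff ℝ 1 Q)
    {c : ℝ → Param d₀ d₁ d₂} {K : NNReal} {a b : ℝ} (hc : LipschitzOnWith K c (Set.Icc a b)) :
    ∃ K', LipschitzOnWith K' (fun r => Q ((c r, r), loss X Y (c r))) (Set.Icc a b) := by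
  obtain ⟨K₁, hK₁⟩ := (locallyLipschitz_loss X Y).exists_lipschitzOnWith_comp hc
  exact hQ.locallyLipschitz.exists_lipschitzOnWith_comp
    ((hc.prodMk LipschitzWith.id.lipschitzOnWith).prodMk hK₁)

/-- With `e` the fixed unit vector towards `θ t`, the quantity `⟨e, θ r⟩ + L/2 - r/2` is
nonincreasing, its derivative being at most `-(‖g‖ - 1)²/2`. Valid from every initial point. -/
theorem norm_sub_le_of_isSolutionOn (h : IsSolutionOn (loss X Y) θ₀ (Set.Ico 0 T) θ)
    (ht : t ∈ Set.Ico 0 T) : ‖θ t - θ₀‖ ≤ (t + loss X Y θ₀) / 2 := by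
  obtain ⟨K, hK⟩ := h.exists_lipschitzOnWith (locallyLipschitz_loss X Y) ht
  rcases eq_or_ne (θ t - θ₀) 0 with h0 | h0
  · rw [h0, norm_zero]
    linarith [ht.1, loss_nonneg X Y θ₀]
  obtain ⟨e, he⟩ : ∃ e, e = ‖θ t - θ₀‖⁻¹ • (θ t - θ₀) := ⟨_, rfl⟩
  have hn : ‖e‖ = 1 := by
    rw [he, norm_smul, norm_inv, norm_norm, inv_mul_cancel₀ (norm_ne_zero_iff.2 h0)]
  have hQ : ContDiff ℝ 1 fun q : (Param d₀ d₁ d₂ × ℝ) × ℝ =>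
      inner ℝ e q.1.1 + 1 / 2 * q.2 - q.1.2 / 2 :=
    ((contDiff_const.inner ℝ contDiff_fst.fst).add (contDiff_const.mul contDiff_snd)).sub
      (contDiff_fst.snd.div_const 2)
  obtain ⟨K', hK'⟩ := exists_lipschitzOnWith_comp_loss X Y hQ hK
  have hle := hK'.le_of_ae_hasDerivAt_nonpos ht.1 (by
    filter_upwards [ae_hasDerivAt_of_isSolutionOn h ht.2.le] with r hr hr'
    obtain ⟨s, hs, h1, h2⟩ := hr hr'
    refine ⟨_, ?_, (((hasDerivAt_const r e).inner ℝ h1).add (h2.const_mul (1 / 2))).sub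
      ((hasDerivAt_id r).div_const 2)⟩
    rw [inner_zero_left, inner_neg_right]
    have := abs_real_inner_le_norm e (genGrad X Y s (θ r))
    rw [hn, one_mul] at this
    have := neg_le_of_abs_le this
    nlinarith [sq_nonneg (‖genGrad X Y s (θ r)‖ - 1)])
  simp only [h.1, zero_div, sub_zero] at hle
  have h3 : inner ℝ e (θ t) - inner ℝ e θ₀ = ‖θ t - θ₀‖ := by
    rw [← inner_sub_right, he, inner_smul_left, real_inner_self_eq_norm_sq]
    simp only [conj_trivial]
    field_simp [norm_ne_zero_iff.2 h0]
  linarith [loss_nonneg X Y (θ t)]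

/-- The loss times `exp(rα²)` is nonincreasing. The constant `29/100` lies between the `1/4`
provided by the condition on `F` and `1 - 1/√2`: `(71/100)² > 1/2` gives `‖g‖² ≥ α²‖R‖²/2`. -/
theorem loss_le_of_isSolutionOn (h : IsSolutionOn (loss X Y) θ₀ (Set.Ico 0 T) θ)
    (ht : t ∈ Set.Ico 0 T)
    (hW : ∀ r ∈ Set.Ioo 0 t, opNorm X * ‖projW (θ r - θ₀)‖ ≤ 29 / 100 * alpha X θ₀) :
    loss X Y (θ t) ≤ loss X Y θ₀ * Real.exp (-(t * alpha X θ₀ ^ 2)) := by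
  obtain ⟨K, hK⟩ := h.exists_lipschitzOnWith (locallyLipschitz_loss X Y) ht
  generalize hα : alpha X θ₀ = α at *
  have hα0 : 0 ≤ α := by rw [← hα]; exact Real.sqrt_nonneg _
  have hQ : ContDiff ℝ 1 fun q : (Param d₀ d₁ d₂ × ℝ) × ℝ =>
      q.2 * Real.exp (q.1.2 * α ^ 2) := by fun_prop
  obtain ⟨K', hK'⟩ := exists_lipschitzOnWith_comp_loss X Y hQ hK
  have hle := hK'.le_of_ae_hasDerivAt_nonpos ht.1 (by
    filter_upwards [ae_hasDerivAt_of_isSolutionOn h ht.2.le] with r hr hr'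
    obtain ⟨s, hs, h1, h2⟩ := hr hr'
    refine ⟨_, ?_, h2.mul (((hasDerivAt_id r).mul_const (α ^ 2)).exp)⟩
    have h3 := mul_frobNorm_resid_le X Y s θ₀ (θ r)
    rw [hα] at h3
    have hR := frobNorm_nonneg (resid X Y (θ r))
    have h4 : 71 / 100 * α * frobNorm (resid X Y (θ r)) ≤ ‖genGrad X Y s (θ r)‖ :=
      le_trans (mul_le_mul_of_nonneg_right (by linarith [hW r hr']) hR) h3
    have h5 := pow_le_pow_left₀ (by positivity) h4 2
    have h6 := loss_eq_frobNorm_resid X Y (θ r)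
    have h7 : α ^ 2 * loss X Y (θ r) ≤ ‖genGrad X Y s (θ r)‖ ^ 2 := by
      rw [h6]
      nlinarith [mul_nonneg (sq_nonneg α) (sq_nonneg (frobNorm (resid X Y (θ r))))]
    have h8 := Real.exp_pos (r * α ^ 2)
    simp only [id]
    nlinarith [mul_nonneg (sub_nonneg.2 h7) h8.le])
  simp only [h.1, zero_mul, Real.exp_zero, mul_one] at hle
  rw [Real.exp_neg, ← div_eq_mul_inv, le_div_iff₀ (Real.exp_pos _)]
  exact hle

theorem bounds_of_loss_le (h : IsSolutionOn (loss X Y) θ₀ (Set.Ico 0 T) θ)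
    (ht : t ∈ Set.Ico 0 T) (hα : 0 < alpha X θ₀)
    (hL : ∀ r ∈ Set.Icc 0 t,
      loss X Y (θ r) ≤ loss X Y θ₀ * Real.exp (-(r * alpha X θ₀ ^ 2))) :
    ∃ τ, 0 ≤ τ ∧
      τ ≤ 2 * Real.sqrt 2 * opNorm X * Real.sqrt (loss X Y θ₀) / alpha X θ₀ ^ 2 ∧
      ‖projW (θ t - θ₀)‖ ≤ ‖projV θ₀‖ * Real.sinh τ + ‖projW θ₀‖ * (Real.cosh τ - 1) ∧
      ‖θ t - θ₀‖ ≤ ‖θ₀‖ * (Real.exp τ - 1) := by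
  obtain ⟨K, hK⟩ := h.exists_lipschitzOnWith (locallyLipschitz_loss X Y) ht
  have hae := ae_hasDerivAt_of_isSolutionOn h ht.2.le
  have h0 := h.1
  clear h
  generalize alpha X θ₀ = α at *
  have ha0 := Real.sqrt_nonneg (loss X Y θ₀)
  have hasq := Real.sq_sqrt (loss_nonneg X Y θ₀)
  generalize Real.sqrt (loss X Y θ₀) = a at *
  have hq := opNorm_nonneg X
  obtain ⟨C, hC⟩ : ∃ C, C = opNorm X * (Real.sqrt 2 * a) := ⟨_, rfl⟩
  have hC0 : 0 ≤ C := by rw [hC]; positivity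
  obtain ⟨ρ, hρ⟩ : ∃ ρ : ℝ → ℝ, ρ = fun r => C * Real.exp (-(r * (α ^ 2 / 2))) := ⟨_, rfl⟩
  -- The primitive of `ρ`, bounded for all times by `2C/α²`.
  obtain ⟨τ, hτ⟩ : ∃ τ : ℝ → ℝ, τ = fun r => C * (2 / α ^ 2) *
    (1 - Real.exp (-(r * (α ^ 2 / 2)))) := ⟨_, rfl⟩
  have hρc : Continuous ρ := by rw [hρ]; fun_prop
  have hρ0 : ∀ r, 0 ≤ ρ r := fun r => by rw [hρ]; positivity
  have hτd : ∀ r, HasDerivAt τ (ρ r) r := fun r => by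
    rw [hτ, hρ]
    convert! (((((hasDerivAt_id r).mul_const (α ^ 2 / 2)).neg).exp).const_sub 1).const_mul
      (C * (2 / α ^ 2)) using 1
    simp only [Pi.neg_apply, id]
    field_simp
  have hτ0 : τ 0 = 0 := by rw [hτ]; simp
  have hR : ∀ r ∈ Set.Icc 0 t, opNorm X * frobNorm (resid X Y (θ r)) ≤ ρ r := fun r hr => by
    simp only [hρ, hC]
    rw [mul_assoc]
    refine mul_le_mul_of_nonneg_left ?_ hq
    refine abs_le_of_sq_le_sq' ?_ (by positivity) |>.2
    have h1 := hL r hr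
    rw [loss_eq_frobNorm_resid] at h1
    have h2 : Real.exp (-(r * (α ^ 2 / 2))) ^ 2 = Real.exp (-(r * α ^ 2)) := by
      rw [← Real.exp_nat_mul]; congr 1; push_cast; ring
    rw [mul_pow, mul_pow, Real.sq_sqrt zero_le_two, h2, hasq]
    linarith
  have hcont : ∀ {F : Type} [NormedAddCommGroup F] [NormedSpace ℝ F]
      (Λ : Param d₀ d₁ d₂ →L[ℝ] F), ContinuousOn (fun r => ‖Λ (θ r - θ₀)‖) (Set.Icc 0 t) :=
    fun Λ => (Λ.continuous.comp_continuousOn (hK.continuousOn.sub continuousOn_const)).norm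
  -- Used with the pairs `(W, V)`, `(V, W)` and, for the full displacement, the identity twice.
  have key : ∀ {F F' : Type} [NormedAddCommGroup F] [NormedSpace ℝ F] [FiniteDimensional ℝ F]
      [NormedAddCommGroup F'] [NormedSpace ℝ F'] (Λ : Param d₀ d₁ d₂ →L[ℝ] F)
      (Λ' : Param d₀ d₁ d₂ →L[ℝ] F')
      (_ : ∀ η s, IsPattern X η s → ‖Λ (genGrad X Y s η)‖ ≤
        opNorm X * frobNorm (resid X Y η) * ‖Λ' η‖), ∀ b ∈ Set.Icc 0 t,
      ‖Λ (θ b - θ₀)‖ ≤ ∫ r in (0 : ℝ)..b, ρ r * (‖Λ' θ₀‖ + ‖Λ' (θ r - θ₀)‖) := by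
    intro F F' _ _ _ _ _ Λ Λ' hΛ b hb
    have hsub : Set.Icc 0 b ⊆ Set.Icc 0 t := Set.Icc_subset_Icc_right hb.2
    nth_rewrite 1 [← h0]
    refine (hK.mono hsub).norm_clm_sub_le_integral hb.1 Λ ?_ ?_
    · refine ContinuousOn.intervalIntegrable ?_
      rw [Set.uIcc_of_le hb.1]
      exact hρc.continuousOn.mul (continuousOn_const.add ((hcont Λ').mono hsub))
    · filter_upwards [hae] with r hr hr'
      have hrt : r ∈ Set.Icc 0 t := ⟨hr'.1.le, hr'.2.le.trans hb.2⟩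
      obtain ⟨s, hs, h1, -⟩ := hr ⟨hr'.1, hr'.2.trans_le hb.2⟩
      refine ⟨_, h1, ?_⟩
      rw [map_neg, norm_neg]
      refine (hΛ _ s hs).trans (mul_le_mul (hR r hrt) ?_ (norm_nonneg _) (hρ0 r))
      have h2 : Λ' (θ r) = Λ' θ₀ + Λ' (θ r - θ₀) := by rw [← map_add]; congr 1; abel
      rw [h2]
      exact norm_add_le _ _
  have hexp : Real.exp (-(t * (α ^ 2 / 2))) ≤ 1 :=
    Real.exp_le_one_iff.2 (neg_nonpos.2 (mul_nonneg ht.1 (by positivity)))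
  have hexp0 := Real.exp_pos (-(t * (α ^ 2 / 2)))
  refine ⟨τ t, ?_, ?_, ?_, ?_⟩
  · rw [hτ]
    exact mul_nonneg (by positivity) (sub_nonneg.2 hexp)
  · rw [hτ]
    have h1 : C * (2 / α ^ 2) * (1 - Real.exp (-(t * (α ^ 2 / 2)))) ≤ C * (2 / α ^ 2) * 1 :=
      mul_le_mul_of_nonneg_left (by linarith) (by positivity)
    refine h1.trans_eq ?_
    rw [hC]; ring
  · exact le_sinh_cosh_of_le_integral ht.1 (hcont projW) (hcont projV) hρc hρ0 hτd hτ0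
      (key projW projV fun η s hs => norm_projW_genGrad_le X Y hs)
      (key projV projW fun η s _ => norm_projV_genGrad_le X Y s η)
  · have hid := key (ContinuousLinearMap.id ℝ (Param d₀ d₁ d₂))
      (ContinuousLinearMap.id ℝ (Param d₀ d₁ d₂)) fun η s hs => norm_genGrad_le X Y hs
    have h1 := le_sinh_cosh_of_le_integral ht.1 (hcont (ContinuousLinearMap.id ℝ _))
      (hcont (ContinuousLinearMap.id ℝ _)) hρc hρ0 hτd hτ0 hid hid
    refine h1.trans_eq ?_
    rw [← Real.sinh_add_cosh (τ t)]
    simp only [ContinuousLinearMap.id_apply]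
    ring

theorem opNorm_mul_sinh_cosh_lt (hα : 0 < alpha X θ₀) (hF : condF X Y θ₀ < 1 / 8) {τ : ℝ}
    (hτ0 : 0 ≤ τ)
    (hτ : τ ≤ 2 * Real.sqrt 2 * opNorm X * Real.sqrt (loss X Y θ₀) / alpha X θ₀ ^ 2) :
    opNorm X * (‖projV θ₀‖ * Real.sinh τ + ‖projW θ₀‖ * (Real.cosh τ - 1)) <
      1 / 4 * alpha X θ₀ := by
  have hq := opNorm_nonneg X
  have hv := norm_nonneg (projV θ₀)
  have hw := norm_nonneg (projW θ₀)
  rw [condF, constC₁, constC₂, constC, ← norm_projW, ← norm_projV] at hF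
  generalize opNorm X = q at *
  generalize ‖projV θ₀‖ = v at *
  generalize ‖projW θ₀‖ = w at *
  generalize alpha X θ₀ = α at *
  generalize Real.sqrt (loss X Y θ₀) = a at *
  obtain ⟨p, hp⟩ : ∃ p, p = 2 * Real.sqrt 2 * q * a / α ^ 2 := ⟨_, rfl⟩
  rw [← hp] at hτ
  have hp0 : 0 ≤ p := hτ0.trans hτ
  have h2 : Real.sqrt 2 ^ 2 = 2 := Real.sq_sqrt zero_le_two
  have hp2 : p ^ 2 = 8 * q ^ 2 * a ^ 2 / α ^ 4 := by
    rw [hp, div_pow, mul_pow, mul_pow, mul_pow, h2]; ring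
  have hexp : 4 * q ^ 2 * a ^ 2 / α ^ 4 = p ^ 2 / 2 := by rw [hp2]; ring
  rw [hexp] at hF
  have h3 : Real.sinh τ ≤ p * Real.exp (p ^ 2 / 2) :=
    (Real.sinh_le_sinh.2 hτ).trans (sinh_le_mul_exp_half_sq hp0)
  have h4 : Real.cosh τ - 1 ≤ p ^ 2 / 2 * Real.exp (p ^ 2 / 2) := by
    refine le_trans ?_ (cosh_sub_one_le hp0)
    have := Real.cosh_le_cosh.2 (abs_le_abs_of_nonneg hτ0 hτ)
    linarith
  have e0 := Real.exp_pos (p ^ 2 / 2)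
  generalize Real.exp (p ^ 2 / 2) = e at *
  have h5 : q * (v * Real.sinh τ + w * (Real.cosh τ - 1)) ≤
      q * (v * (p * e) + w * (p ^ 2 / 2 * e)) := by gcongr
  refine h5.trans_lt ?_
  -- The `c₂` term appears doubled, so the sum is at most `2αF < α/4`; this is the origin of the
  -- `1/8`.
  have h6 : q * (v * (p * e) + w * (p ^ 2 / 2 * e)) =
      α * ((a * (2 * Real.sqrt 2 * q ^ 2 * v) / α ^ 3 +
        2 * (a ^ 2 * (2 * q ^ 3 * w) / α ^ 5)) * e) := by
    rw [hp2, hp]; field_simp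
    ring
  have h7 : 0 ≤ a * (2 * Real.sqrt 2 * q ^ 2 * v) / α ^ 3 := by
    have e1 : a * (2 * Real.sqrt 2 * q ^ 2 * v) / α ^ 3 = p * (q * v / α) := by
      rw [hp]; field_simp
    rw [e1]; positivity
  rw [h6]
  have h8 := mul_nonneg h7 e0.le
  nlinarith

/-- Continuity argument: up to the first time `b` at which the threshold is reached the loss decays,
hence the displacement at `b` is below `α/4`, strictly under the threshold. -/
theorem opNorm_mul_norm_projW_le (h : IsSolutionOn (loss X Y) θ₀ (Set.Ico 0 T) θ)
    (hα : 0 < alpha X θ₀) (hF : condF X Y θ₀ < 1 / 8) (ht : t ∈ Set.Ico 0 T) :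
    opNorm X * ‖projW (θ t - θ₀)‖ ≤ 29 / 100 * alpha X θ₀ := by
  by_contra! hcon
  have hφ : ContinuousOn (fun r => opNorm X * ‖projW (θ r - θ₀)‖) (Set.Icc 0 t) :=
    continuousOn_const.mul (projW.continuous.comp_continuousOn
      ((h.2.1.continuousOn ht).sub continuousOn_const)).norm
  have hcpt : IsCompact (Set.Icc 0 t ∩
      (fun r => opNorm X * ‖projW (θ r - θ₀)‖) ⁻¹' Set.Ici (29 / 100 * alpha X θ₀)) :=
    isCompact_Icc.of_isClosed_subset (hφ.preimage_isClosed_of_isClosed isClosed_Icc isClosed_Ici)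
      Set.inter_subset_left
  obtain ⟨b, ⟨hb1, hb2⟩, hleast⟩ := hcpt.exists_isLeast ⟨t, ⟨ht.1, le_rfl⟩, hcon.le⟩
  simp only [Set.mem_preimage, Set.mem_Ici] at hb2
  have hbT : b < T := hb1.2.trans_lt ht.2
  have hW : ∀ r, 0 ≤ r → r < b → opNorm X * ‖projW (θ r - θ₀)‖ ≤ 29 / 100 * alpha X θ₀ := by
    intro r hr0 hrb
    by_contra! hr
    exact absurd hrb (not_lt.2 (hleast ⟨⟨hr0, hrb.le.trans hb1.2⟩, hr.le⟩))
  obtain ⟨τ, hτ0, hτ, hA, -⟩ := bounds_of_loss_le h ⟨hb1.1, hbT⟩ hα fun r hr =>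
    loss_le_of_isSolutionOn h ⟨hr.1, hr.2.trans_lt hbT⟩ fun s hs =>
      hW s hs.1.le (hs.2.trans_le hr.2)
  have h1 := opNorm_mul_sinh_cosh_lt hα hF hτ0 hτ
  have h2 := mul_le_mul_of_nonneg_left hA (opNorm_nonneg X)
  linarith

theorem loss_le_and_norm_sub_le (h : IsSolutionOn (loss X Y) θ₀ (Set.Ico 0 T) θ)
    (hα : 0 < alpha X θ₀) (hF : condF X Y θ₀ < 1 / 8) (ht : t ∈ Set.Ico 0 T) {u : ℝ}
    (hu : u = 4 * opNorm X * Real.sqrt (loss X Y θ₀) / alpha X θ₀ ^ 2) :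
    loss X Y (θ t) ≤ loss X Y θ₀ * Real.exp (-(t * alpha X θ₀ ^ 2)) ∧
      ‖θ t - θ₀‖ ≤ u * ‖θ₀‖ * Real.exp u := by
  have hL : ∀ r ∈ Set.Icc 0 t,
      loss X Y (θ r) ≤ loss X Y θ₀ * Real.exp (-(r * alpha X θ₀ ^ 2)) := fun r hr =>
    loss_le_of_isSolutionOn h ⟨hr.1, hr.2.trans_lt ht.2⟩ fun s hs =>
      opNorm_mul_norm_projW_le h hα hF ⟨hs.1.le, (hs.2.trans_le hr.2).trans ht.2⟩
  refine ⟨hL t ⟨ht.1, le_rfl⟩, ?_⟩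
  obtain ⟨τ, hτ0, hτ, -, hB⟩ := bounds_of_loss_le h ht hα hL
  -- This rounds `2√2` in the bound for `τ` up to the `4` in `u`.
  have hsq : Real.sqrt 2 ≤ 2 := by
    rw [Real.sqrt_le_left two_pos.le]; norm_num
  have hτu : τ ≤ u := by
    refine hτ.trans ?_
    rw [hu]
    have := opNorm_nonneg X
    gcongr
    linarith
  have h1 : Real.exp τ - 1 ≤ u * Real.exp u :=
    (exp_sub_one_le_mul_exp τ).trans (mul_le_mul hτu (Real.exp_le_exp.2 hτu)
      (Real.exp_pos _).le (hτ0.trans hτu))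
  calc ‖θ t - θ₀‖ ≤ ‖θ₀‖ * (Real.exp τ - 1) := hB
    _ ≤ ‖θ₀‖ * (u * Real.exp u) := by gcongr
    _ = u * ‖θ₀‖ * Real.exp u := by ring

theorem exists_isSolutionOn_Ici_loss (X : Matrix (Fin N) (Fin d₀) ℝ)
    (Y : Matrix (Fin N) (Fin d₂) ℝ) (θ₀ : Param d₀ d₁ d₂) :
    ∃ η : ℝ → Param d₀ d₁ d₂, IsSolutionOn (loss X Y) θ₀ (Set.Ici 0) η ∧
      ∀ t, 0 ≤ t → ∃ K, LipschitzOnWith K η (Set.Icc 0 t) := by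
  have hL := loss_nonneg X Y θ₀
  refine exists_isSolutionOn_Ici (locallyLipschitz_loss X Y)
    (isClosed_clarkeSubdifferential_loss X Y) θ₀ (c := loss X Y θ₀) hL fun T _ x hx t ht => ?_
  have := norm_sub_le_of_isSolutionOn hx ht
  linarith [ht.1]

theorem exists_lipschitzOnWith_Ico (h : IsSolutionOn (loss X Y) θ₀ (Set.Ico 0 T) θ) :
    ∃ K, LipschitzOnWith K θ (Set.Ico 0 T) := by
  obtain ⟨M, hM0, hM⟩ := (locallyLipschitz_loss X Y).exists_norm_clarkeSubdifferential_le
    (isCompact_closedBall θ₀ ((T + loss X Y θ₀) / 2))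
  refine ⟨NNReal.mk M hM0, fun r hr s hs => ?_⟩
  have hm : max r s ∈ Set.Ico 0 T := ⟨hr.1.trans (le_max_left _ _), max_lt hr.2 hs.2⟩
  refine h.lipschitzOnWith (M := NNReal.mk M hM0) hm (fun b hb g hg => hM _ ?_ g hg)
    ⟨hr.1, le_max_left _ _⟩ ⟨hs.1, le_max_right _ _⟩
  rw [Metric.mem_closedBall, dist_eq_norm]
  have := norm_sub_le_of_isSolutionOn h ⟨hb.1, hb.2.trans_lt hm.2⟩
  linarith [hb.2, hm.2]

end ReLUNet

theorem theorem3p4 (N d₀ d₁ d₂ : ℕ) (hN : 0 < N) (hd₀ : 0 < d₀) (hd₁ : 0 < d₁) (hd₂ : 0 < d₂)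
    (X : Matrix (Fin N) (Fin d₀) ℝ) (Y : Matrix (Fin N) (Fin d₂) ℝ)
    (θ₀ : ReLUNet.Param d₀ d₁ d₂)
    (hα : 0 < ReLUNet.alpha X θ₀)
    (hF : ReLUNet.condF X Y θ₀ < 1 / 8)
    (T : ℝ) (hT : 0 < T) (θ : ℝ → ReLUNet.Param d₀ d₁ d₂)
    (hθ : IsSolutionOn (ReLUNet.loss X Y) θ₀ (Set.Ico 0 T) θ) :
    (∃ η : ℝ → ReLUNet.Param d₀ d₁ d₂,
      IsSolutionOn (ReLUNet.loss X Y) θ₀ (Set.Ici 0) η ∧ Set.EqOn η θ (Set.Ico 0 T)) ∧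
    ∀ η : ℝ → ReLUNet.Param d₀ d₁ d₂,
      IsSolutionOn (ReLUNet.loss X Y) θ₀ (Set.Ici 0) η → Set.EqOn η θ (Set.Ico 0 T) →
      ∀ t : ℝ, 0 ≤ t →
        ReLUNet.loss X Y (η t) ≤
          ReLUNet.loss X Y θ₀ * Real.exp (-(t * ReLUNet.alpha X θ₀ ^ 2)) ∧
        ∀ u : ℝ,
          u = 4 * ReLUNet.opNorm X * Real.sqrt (ReLUNet.loss X Y θ₀) / ReLUNet.alpha X θ₀ ^ 2 →
          ‖η t - θ₀‖ ≤ u * ‖θ₀‖ * Real.exp u := by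
  constructor
  · obtain ⟨K, hK⟩ := ReLUNet.exists_lipschitzOnWith_Ico hθ
    exact hθ.exists_extension hT hK (ReLUNet.exists_isSolutionOn_Ici_loss X Y)
  · intro η hη _ t ht
    -- Any horizon beyond `t` serves, since the estimates do not depend on it.
    have h : IsSolutionOn (ReLUNet.loss X Y) θ₀ (Set.Ico 0 (t + 1)) η :=
      hη.mono Set.Ico_subset_Ici_self
    have hb := fun u hu => ReLUNet.loss_le_and_norm_sub_le (u := u) h hα hF
      ⟨ht, lt_add_one t⟩ hu
    exact ⟨(hb _ rfl).1, fun u hu => (hb u hu).2⟩
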